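/- Let $n,m\ge 1$ be integers and let $\mathbb{B}^n$ be the open unit ball of $\mathbb{R}^n$. A continuously differentiable increasing bijection $\psi:(0,\infty)\to(0,\infty)$ is called an allowable modulus of continuity if there exist $t_0\in(0,1)$ and $\beta>0$ such that on $(0,t_0]$: (i) $t\mapsto\log\frac{1}{\psi^{-1}(t)}$ is differentiable and $t\mapsto\frac{(\psi^{-1})'(t)}{\psi^{-1}(t)}\,t$ is decreasing (in the weak sense); (ii) $\log\frac{1}{\psi^{-1}(t)}\le\beta\log\frac{1}{\psi^{-1}(\sqrt t)}$; (iii) $t\mapsto\frac{(\log\psi(t))'\,t\log t}{\log\psi(t)}$ is monotone (non-decreasing or non-increasing). **Theorem 1.1.** Let $f:\overline{\mathbb{B}^n}\to\mathbb{R}^m$ be continuous with $f\in W^{1,n}(\mathbb{B}^n,\mathbb{R}^m)$, that is, $f\in L^n(\mathbb{B}^n,\mathbb{R}^m)$ has weak first order partial derivatives in $L^n(\mathbb{B}^n,\mathbb{R}^m)$. Suppose that $$|f(z)-f(w)|\le\psi(|z-w|)\qquad\text{for all } z\neq w \text{ in } \overline{\mathbb{B}^n},$$ where $\psi$ is an allowable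 modulus of continuity with $$\int_0\left|\frac{\log\psi(t)}{\log t}\right|^n\frac{dt}{t}=\infty,$$ that is, the integral over $(0,\varepsilon)$ is infinite for every $\varepsilon>0$. Then $\mathcal{H}^n(f(\partial\mathbb{B}^n))=0$, where $\mathcal{H}^n$ is the $n$-dimensional Hausdorff measure on $\mathbb{R}^m$. -/

import Mathlib

open Set MeasureTheory
open scoped ENNReal ContDiff

/-- `g` is the weak `i`-th partial derivative of the vector-valued function `f` on the open set `Ω`,
that is, `∫ (∂ᵢφ) f = -∫ φ g` over `Ω` for all real test functions `φ ∈ C_c^∞(Ω)`.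
Meant for `f` and `g` locally integrable on `Ω`. -/
def IsWeakPartialDeriv {n m : ℕ} (Ω : Set (EuclideanSpace ℝ (Fin n))) (i : Fin n)
    (f g : EuclideanSpace ℝ (Fin n) → EuclideanSpace ℝ (Fin m)) : Prop :=
  ∀ φ : EuclideanSpace ℝ (Fin n) → ℝ,
    ContDiff ℝ ∞ φ → HasCompactSupport φ → tsupport φ ⊆ Ω →
      ∫ x in Ω, (fderiv ℝ φ x (EuclideanSpace.single i 1)) • f x = -∫ x in Ω, φ x • g x

/-- `f ∈ W^{1,p}(Ω, ℝᵐ)` for `1 ≤ p`: `f` is in `Lᵖ(Ω)` and has all its weak first order partial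
derivatives in `Lᵖ(Ω)`. -/
structure MemSobolevOne {n m : ℕ} (Ω : Set (EuclideanSpace ℝ (Fin n))) (p : ℝ≥0∞)
    (f : EuclideanSpace ℝ (Fin n) → EuclideanSpace ℝ (Fin m)) : Prop where
  memLp : MemLp f p (volume.restrict Ω)
  exists_weakDeriv : ∀ i : Fin n, ∃ g : EuclideanSpace ℝ (Fin n) → EuclideanSpace ℝ (Fin m),
    MemLp g p (volume.restrict Ω) ∧ IsWeakPartialDeriv Ω i f g

/-- The inverse function `ψ⁻¹ : (0,∞) → (0,∞)` of a bijection `ψ : (0,∞) → (0,∞)`. -/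
noncomputable def modInv (ψ : ℝ → ℝ) : ℝ → ℝ := Function.invFunOn ψ (Ioi 0)

/-- Allowable moduli of continuity. Functions on `(0,∞)` are represented by functions on `ℝ`, only
the values on `(0,∞)` being used. -/
structure IsAllowableModulus (ψ : ℝ → ℝ) : Prop where
  bijOn : BijOn ψ (Ioi 0) (Ioi 0)
  strictMonoOn : StrictMonoOn ψ (Ioi 0)
  contDiffOn : ContDiffOn ℝ 1 ψ (Ioi 0)
  conditions : ∃ t₀ β : ℝ, 0 < t₀ ∧ t₀ < 1 ∧ 0 < β ∧
    (∀ t ∈ Ioc 0 t₀, DifferentiableAt ℝ (fun s => Real.log (1 / modInv ψ s)) t) ∧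
    AntitoneOn (fun t => deriv (modInv ψ) t / modInv ψ t * t) (Ioc 0 t₀) ∧
    (∀ t ∈ Ioc 0 t₀,
      Real.log (1 / modInv ψ t) ≤ β * Real.log (1 / modInv ψ (Real.sqrt t))) ∧
    (MonotoneOn (fun t => deriv (fun s => Real.log (ψ s)) t * t * Real.log t / Real.log (ψ t))
        (Ioc 0 t₀) ∨
      AntitoneOn (fun t => deriv (fun s => Real.log (ψ s)) t * t * Real.log t / Real.log (ψ t))
        (Ioc 0 t₀))

/-- The condition `∫₀ |log ψ(t) / log t|ⁿ dt/t = ∞`: the integral of this non-negative function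
over every interval `(0, ε)` is infinite. -/
def LogDivergence (n : ℕ) (ψ : ℝ → ℝ) : Prop :=
  ∀ ε : ℝ, 0 < ε →
    ∫⁻ t in Ioo 0 ε, ENNReal.ofReal (|Real.log (ψ t) / Real.log t| ^ n / t) = ⊤

/-! For `n = 1` the sphere is finite. For `n ≥ 2` suppose that the image of the sphere has positive
measure. Then its coverings have `n`-content at least some `c > 0`, so for every `η > 0` it carries
finitely many point masses of total mass `W > c` with at most `4 ^ n * r ^ n` in each ball of radius
`r ≥ η` (`exists_frostman_weights`).

Take `η = ψ(2⁻ᴺ)` and follow each mass point `p = f(x)` through averages of `f` over balls of radius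
comparable to `2⁻ʲ` near `x`, `j ≤ N`. Let `d j` be the distance from the average to `p`, truncated
below at `η`. The modulus gives `d N = η`, and telescoping `log d` bounds `log (1/η)` by `1 / d 0`
plus the sum of jump over `d (j+1)`. A jump is at most a constant times the `n`-th root of the
energy `∑ ∫ |∂ᵢf|ⁿ` near `x` at depth about `2⁻ʲ` (`exists_norm_ballAverage_sub_le`). Averaging over
the masses, the growth bound controls `1/d`, and Hölder over cells of bounded overlap
(`sum_weight_mul_div_le`) leaves only the `n`-th root of the energy `E j` of a whole spherical
shell.

Hence `log (1/ψ(2⁻ᴺ)) ≤ C (1 + ∑_{j<N} (E j)^(1/n))`, where `∑ E j` is finite. By Hardy's inequality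
(`sum_average_pow_le`) the quotients `log ψ(2⁻ᴺ) / N` are in `ℓⁿ`, which contradicts the divergence
of the integral (`not_logDivergence`). -/

/-! ### Discrete inequalities: Hardy, and weighted sums of reciprocals -/

/-- Young's inequality; it makes the sums in the proof of Hardy's inequality telescope. -/
theorem succ_mul_pow_mul_le {a b : ℝ} (ha : 0 ≤ a) (hb : 0 ≤ b) (p : ℕ) :
    ((p : ℝ) + 1) * (a ^ p * b) ≤ b ^ (p + 1) + p * a ^ (p + 1) := by
  induction p with
  | zero => simp
  | succ p ih =>
    have h1 := mul_le_mul_of_nonneg_right ih ha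
    have h2 : 0 ≤ (a - b) * (a ^ (p + 1) - b ^ (p + 1)) := by
      rcases le_total a b with h | h
      · exact mul_nonneg_of_nonpos_of_nonpos (sub_nonpos.2 h)
          (sub_nonpos.2 (pow_le_pow_left₀ ha h _))
      · exact mul_nonneg (sub_nonneg.2 h) (sub_nonneg.2 (pow_le_pow_left₀ hb h _))
    push_cast
    ring_nf at h1 h2 ⊢
    linarith

/-- A finite form of the discrete Hardy inequality with a non-sharp constant. -/
theorem sum_average_pow_le (b : ℕ → ℝ) (hb : ∀ k, 0 ≤ b k) {n : ℕ} (hn : 2 ≤ n) (N : ℕ) :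
    ∑ k ∈ Finset.range N, ((∑ j ∈ Finset.range (k + 1), b j) / ((k : ℝ) + 1)) ^ n
      ≤ 4 ^ n * ∑ k ∈ Finset.range N, b k ^ n := by
  obtain ⟨p, rfl⟩ : ∃ p, n = p + 1 := ⟨n - 1, by omega⟩
  have hp : (1 : ℝ) ≤ p := by exact_mod_cast (by omega : 1 ≤ p)
  set α : ℕ → ℝ := fun k => (∑ j ∈ Finset.range (k + 1), b j) / ((k : ℝ) + 1) with hα
  have hα0 : ∀ k, 0 ≤ α k := fun k =>
    div_nonneg (Finset.sum_nonneg fun j _ => hb j) (by positivity)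
  have hrec : ∀ k, b (k + 1) = ((k : ℝ) + 2) * α (k + 1) - ((k : ℝ) + 1) * α k := by
    intro k
    simp only [hα]
    rw [Finset.sum_range_succ _ (k + 1)]
    have : (k : ℝ) + 1 ≠ 0 := by positivity
    have : (k : ℝ) + 2 ≠ 0 := by positivity
    push_cast
    have e : (k : ℝ) + 1 + 1 = k + 2 := by ring
    rw [e]
    field_simp
    ring
  -- Elliott's argument: insert `hrec` for `b` and apply Young's inequality to consecutive averages.
  -- The boundary term on the left is kept for the induction.
  have key : ∀ N : ℕ, p * ∑ k ∈ Finset.range (N + 1), α k ^ (p + 1) + (N + 1) * α N ^ (p + 1)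
      ≤ (p + 1) * ∑ k ∈ Finset.range (N + 1), α k ^ p * b k := by
    intro N
    induction N with
    | zero =>
      have : α 0 = b 0 := by simp [hα]
      simp [this]
      ring_nf
      rfl
    | succ N ih =>
      rw [Finset.sum_range_succ _ (N + 1), Finset.sum_range_succ _ (N + 1), mul_add, mul_add,
        hrec N]
      have h := mul_le_mul_of_nonneg_left (succ_mul_pow_mul_le (hα0 (N + 1)) (hα0 N) p)
        (by positivity : (0 : ℝ) ≤ N + 1)
      push_cast
      ring_nf at h ih ⊢
      linarith
  -- The factor `1 / 4` allows absorption: since `p + 1 ≤ 2 * p`, the `α` terms return with total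
  -- coefficient at most `p / 2`.
  have pt : ∀ k, α k ^ p * b k ≤ (1 / 4) * α k ^ (p + 1) + 4 ^ p * b k ^ (p + 1) := by
    intro k
    have h1 := hα0 k
    have h2 := hb k
    rcases le_total (b k) (α k / 4) with h | h
    · have := mul_le_mul_of_nonneg_left h (pow_nonneg h1 p)
      have h3 : 0 ≤ (4 : ℝ) ^ p * b k ^ (p + 1) := by positivity
      rw [pow_succ]
      linarith
    · have h4 : α k ^ p ≤ (4 * b k) ^ p := pow_le_pow_left₀ h1 (by linarith) p
      have := mul_le_mul_of_nonneg_right h4 h2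
      have h3 : 0 ≤ (1 / 4 : ℝ) * α k ^ (p + 1) := by positivity
      rw [mul_pow] at this
      rw [pow_succ (b k)]
      linarith
  cases N with
  | zero => simp
  | succ N =>
    have h1 := key N
    have h2 : ∑ k ∈ Finset.range (N + 1), α k ^ p * b k ≤
        (1 / 4) * ∑ k ∈ Finset.range (N + 1), α k ^ (p + 1)
          + 4 ^ p * ∑ k ∈ Finset.range (N + 1), b k ^ (p + 1) := by
      rw [Finset.mul_sum, Finset.mul_sum, ← Finset.sum_add_distrib]
      exact Finset.sum_le_sum fun k _ => pt k
    set A := ∑ k ∈ Finset.range (N + 1), α k ^ (p + 1)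
    set T := ∑ k ∈ Finset.range (N + 1), b k ^ (p + 1)
    set M := ∑ k ∈ Finset.range (N + 1), α k ^ p * b k
    have hA : 0 ≤ A := Finset.sum_nonneg fun k _ => pow_nonneg (hα0 k) _
    have hT : 0 ≤ 4 ^ p * T := mul_nonneg (by positivity)
      (Finset.sum_nonneg fun k _ => pow_nonneg (hb k) _)
    have h3 : 0 ≤ ((N : ℝ) + 1) * α N ^ (p + 1) := by have := hα0 N; positivity
    have h4 : (p : ℝ) * A ≤ (p + 1) * ((1 / 4) * A + 4 ^ p * T) :=
      (by linarith : (p : ℝ) * A ≤ (p + 1) * M).trans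
        (mul_le_mul_of_nonneg_left h2 (by positivity))
    have h5 : (p + 1 : ℝ) * ((1 / 4) * A + 4 ^ p * T) ≤ (2 * p) * ((1 / 4) * A + 4 ^ p * T) :=
      mul_le_mul_of_nonneg_right (by linarith) (by positivity)
    have h6 : (p : ℝ) * A ≤ p * ((1 / 2) * A + 2 * (4 ^ p * T)) := by linarith
    have h7 := le_of_mul_le_mul_left h6 (by linarith)
    rw [pow_succ]
    linarith

/-- If a finite weighted set has mass at most `C rⁿ` on each sublevel set `{d ≤ r}`, then the
weighted sum of `1 / d` is controlled by the total mass. -/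
theorem sum_weight_div_le {ι : Type*} {n : ℕ} (hn : 2 ≤ n) {C : ℝ} (hC : 0 < C)
    (w d : ι → ℝ) (hw : ∀ i, 0 ≤ w i) (hd : ∀ i, 0 < d i) (s : Finset ι)
    (h : ∀ r > 0, ∑ i ∈ s with d i ≤ r, w i ≤ C * r ^ n) :
    ∑ i ∈ s, w i / d i ≤ 2 * C ^ (1 / n : ℝ) * (∑ i ∈ s, w i) ^ (1 - 1 / n : ℝ) := by
  classical
  have hn' : (2 : ℝ) ≤ n := by exact_mod_cast hn
  have hn0 : (n : ℝ) ≠ 0 := by positivity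
  have hp1 : (1 / n : ℝ) ≤ 1 / 2 := one_div_le_one_div_of_le two_pos hn'
  have hp0 : (0 : ℝ) < 1 / n := by positivity
  -- Points are added in increasing order of `d`. All mass so far then lies in `{d ≤ d a}`, which
  -- bounds `1 / d a` by a power of that mass; the claim becomes a discrete `∫ x^(-1/n) dx`.
  induction s using Finset.induction_on_max_value d with
  | empty =>
    simp only [Finset.sum_empty]
    positivity
  | insert a s has hmax ih =>
    have ih' := ih fun r hr => (Finset.sum_le_sum_of_subset_of_nonneg
      (Finset.filter_subset_filter _ (Finset.subset_insert _ _)) (fun i _ _ => hw i)).trans (h r hr)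
    have hall := h (d a) (hd a)
    rw [Finset.filter_true_of_mem (by
      intro i hi
      rcases Finset.mem_insert.1 hi with rfl | hi
      · exact le_rfl
      · exact hmax i hi)] at hall
    rw [Finset.sum_insert has] at hall ⊢
    rw [Finset.sum_insert has]
    set S := ∑ i ∈ s, w i
    have hS : 0 ≤ S := Finset.sum_nonneg fun i _ => hw i
    have hwa := hw a
    rcases hwa.eq_or_lt with h0 | hpos
    · rw [← h0]; simpa using ih'
    have hSw : 0 < w a + S := by linarith
    have h1 : (w a + S) ^ (1 / n : ℝ) ≤ C ^ (1 / n : ℝ) * d a := by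
      have := Real.rpow_le_rpow hSw.le hall hp0.le
      rwa [Real.mul_rpow hC.le (by have := hd a; positivity), one_div,
        Real.pow_rpow_inv_natCast (hd a).le (by omega), ← one_div] at this
    have h2 : w a / d a ≤ C ^ (1 / n : ℝ) * (w a * (w a + S) ^ (-(1 / n : ℝ))) := by
      rw [Real.rpow_neg hSw.le, div_le_iff₀ (hd a)]
      have h3 : 0 < (w a + S) ^ (1 / n : ℝ) := Real.rpow_pos_of_pos hSw _
      calc w a = w a * ((w a + S) ^ (1 / n : ℝ))⁻¹ * (w a + S) ^ (1 / n : ℝ) := by field_simp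
        _ ≤ w a * ((w a + S) ^ (1 / n : ℝ))⁻¹ * (C ^ (1 / n : ℝ) * d a) := by gcongr
        _ = _ := by ring
    -- Concavity of the power (Bernoulli). Its exponent is at least `1 / 2`, whence the factor `2`
    -- in the conclusion.
    have h4 : S ^ (1 - 1 / n : ℝ) ≤ (w a + S) ^ (1 - 1 / n : ℝ)
        - (1 / 2) * (w a * (w a + S) ^ (-(1 / n : ℝ))) := by
      have hq : S = (w a + S) * (1 + -(w a / (w a + S))) := by field_simp; ring
      have hle : w a / (w a + S) ≤ 1 := (div_le_one hSw).2 (by linarith)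
      have hb := rpow_one_add_le_one_add_mul_self (s := -(w a / (w a + S))) (by linarith)
        (p := 1 - 1 / n) (by linarith) (by linarith)
      have hX : (w a + S) ^ (1 - 1 / n : ℝ) = (w a + S) * (w a + S) ^ (-(1 / n : ℝ)) := by
        rw [sub_eq_add_neg, Real.rpow_add hSw, Real.rpow_one]
      have hq0 : 0 ≤ w a / (w a + S) := by positivity
      calc S ^ (1 - 1 / n : ℝ)
          = (w a + S) ^ (1 - 1 / n : ℝ) * (1 + -(w a / (w a + S))) ^ (1 - 1 / n : ℝ) := by
            conv_lhs => rw [hq]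
            rw [Real.mul_rpow hSw.le (by linarith)]
        _ ≤ (w a + S) ^ (1 - 1 / n : ℝ) * (1 - (1 / 2) * (w a / (w a + S))) := by
            refine mul_le_mul_of_nonneg_left (hb.trans ?_) (by positivity)
            nlinarith
        _ = _ := by rw [hX]; field_simp
    have h5 := mul_le_mul_of_nonneg_left h4 (by positivity : 0 ≤ 2 * C ^ (1 / n : ℝ))
    linarith

/-- The preceding bound on each cell of `c`, followed by Hölder with exponents `n` and `n / (n -
1)`: the cell masses add up to the total mass. -/
theorem sum_weight_mul_div_le {ι κ : Type*} [DecidableEq κ] {n : ℕ} (hn : 2 ≤ n) {C : ℝ} (hC : 0 < C)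
    (w d : ι → ℝ) (hw : ∀ i, 0 ≤ w i) (hd : ∀ i, 0 < d i) (s : Finset ι) (c : ι → κ)
    (t : Finset κ) (hct : ∀ i ∈ s, c i ∈ t) (α : κ → ℝ) (hα : ∀ k, 0 ≤ α k)
    (h : ∀ k, ∀ r > 0, ∑ i ∈ s with c i = k ∧ d i ≤ r, w i ≤ C * r ^ n) :
    ∑ i ∈ s, w i * (α (c i) / d i) ≤
      2 * C ^ (1 / n : ℝ) * (∑ i ∈ s, w i) ^ (1 - 1 / n : ℝ) * (∑ k ∈ t, α k ^ n) ^ (1 / n : ℝ) := by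
  classical
  have hn' : (2 : ℝ) ≤ n := by exact_mod_cast hn
  have hpq : (n : ℝ).HolderConjugate (1 - 1 / n : ℝ)⁻¹ := by
    rw [Real.holderConjugate_iff]
    refine ⟨by linarith, ?_⟩
    rw [inv_inv, one_div]; ring
  have hq : (1 - 1 / n : ℝ) ≠ 0 := by
    have : (1 / n : ℝ) ≤ 1 / 2 := one_div_le_one_div_of_le two_pos hn'
    linarith
  set σ : κ → ℝ := fun k => ∑ i ∈ s with c i = k, w i with hσ
  have hσ0 : ∀ k, 0 ≤ σ k := fun k => Finset.sum_nonneg fun i _ => hw i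
  have h1 : ∑ i ∈ s, w i * (α (c i) / d i) =
      ∑ k ∈ t, α k * ∑ i ∈ s with c i = k, w i / d i := by
    rw [← Finset.sum_fiberwise_of_maps_to hct]
    refine Finset.sum_congr rfl fun k _ => ?_
    rw [Finset.mul_sum]
    refine Finset.sum_congr rfl fun i hi => ?_
    rw [(Finset.mem_filter.1 hi).2]
    ring
  have h2 : ∀ k ∈ t, α k * ∑ i ∈ s with c i = k, w i / d i ≤
      2 * C ^ (1 / n : ℝ) * (α k * σ k ^ (1 - 1 / n : ℝ)) := by
    intro k _
    have := sum_weight_div_le hn hC w d hw hd (s.filter fun i => c i = k) (fun r hr => by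
      rw [Finset.filter_filter]; exact h k r hr)
    calc _ ≤ α k * (2 * C ^ (1 / n : ℝ) * σ k ^ (1 - 1 / n : ℝ)) :=
          mul_le_mul_of_nonneg_left this (hα k)
      _ = _ := by ring
  have h3 := Real.inner_le_Lp_mul_Lq_of_nonneg t hpq (f := α)
    (g := fun k => σ k ^ (1 - 1 / n : ℝ)) (fun k _ => hα k)
    (fun k _ => Real.rpow_nonneg (hσ0 k) _)
  have h4 : ∑ k ∈ t, (σ k ^ (1 - 1 / n : ℝ)) ^ ((1 - 1 / n : ℝ)⁻¹) = ∑ i ∈ s, w i := by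
    rw [← Finset.sum_fiberwise_of_maps_to hct]
    exact Finset.sum_congr rfl fun k _ => Real.rpow_rpow_inv (hσ0 k) hq
  rw [h4, one_div, one_div, inv_inv] at h3
  simp only [Real.rpow_natCast] at h3
  rw [h1]
  refine (Finset.sum_le_sum h2).trans ?_
  rw [← Finset.mul_sum]
  have := mul_le_mul_of_nonneg_left h3 (by positivity : 0 ≤ 2 * C ^ (1 / n : ℝ))
  rw [one_div] at this ⊢
  linarith

/-! ### Frostman weights and Hausdorff measure -/

open Classical in
/-- Given finitely many sets with capacities which cover a finite set `P`, there are weights on `P`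
respecting all capacities such that each point of `P` lies in a saturated set. -/
theorem exists_saturated_weights {α ι : Type*} (I : Finset ι) (B : ι → Set α) (b : ι → ℝ)
    (hb : ∀ i ∈ I, 0 ≤ b i) (P : Finset α) (hP : ∀ p ∈ P, ∃ i ∈ I, p ∈ B i) :
    ∃ w : α → ℝ, (∀ p, 0 ≤ w p) ∧ (∀ i ∈ I, ∑ p ∈ P with p ∈ B i, w p ≤ b i) ∧
      ∀ p ∈ P, ∃ i ∈ I, p ∈ B i ∧ ∑ q ∈ P with q ∈ B i, w q = b i := by
  induction P using Finset.induction_on with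
  | empty => exact ⟨fun _ => 0, fun _ => le_rfl, by simpa using hb, by simp⟩
  | insert a P haP ih =>
    obtain ⟨w, hw0, hwb, hws⟩ := ih fun p hp => hP p (Finset.mem_insert_of_mem hp)
    obtain ⟨i₀, hi₀, hai₀⟩ := hP a (Finset.mem_insert_self _ _)
    have hne : (I.filter fun i => a ∈ B i).Nonempty := ⟨i₀, Finset.mem_filter.2 ⟨hi₀, hai₀⟩⟩
    -- The new point receives the least remaining capacity among the sets containing it: one of them
    -- becomes saturated and none overflows.
    obtain ⟨j, hj, hjmin⟩ := Finset.exists_min_image _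
      (fun i => b i - ∑ p ∈ P with p ∈ B i, w p) hne
    obtain ⟨hjI, haj⟩ := Finset.mem_filter.1 hj
    set δ := b j - ∑ p ∈ P with p ∈ B j, w p with hδ
    have hδ0 : 0 ≤ δ := sub_nonneg.2 (hwb j hjI)
    set w' : α → ℝ := Function.update w a δ with hw'
    have hold : ∀ i, ∑ p ∈ P with p ∈ B i, w' p = ∑ p ∈ P with p ∈ B i, w p := fun i =>
      Finset.sum_congr rfl fun p hp => Function.update_of_ne
        (by rintro rfl; exact haP (Finset.mem_filter.1 hp).1) _ _
    have hin : ∀ i, a ∈ B i → ∑ p ∈ insert a P with p ∈ B i, w' p =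
        δ + ∑ p ∈ P with p ∈ B i, w p := by
      intro i hi
      rw [Finset.filter_insert, if_pos hi, Finset.sum_insert (by simp [haP]), hold]
      simp [hw']
    have hout : ∀ i, a ∉ B i → ∑ p ∈ insert a P with p ∈ B i, w' p =
        ∑ p ∈ P with p ∈ B i, w p := by
      intro i hi
      rw [Finset.filter_insert, if_neg hi, hold]
    have hcap : ∀ i ∈ I, ∑ p ∈ insert a P with p ∈ B i, w' p ≤ b i := by
      intro i hi
      by_cases hai : a ∈ B i
      · rw [hin i hai]
        have := hjmin i (Finset.mem_filter.2 ⟨hi, hai⟩)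
        linarith
      · rw [hout i hai]; exact hwb i hi
    refine ⟨w', fun p => ?_, hcap, fun p hp => ?_⟩
    · by_cases h : p = a
      · subst h; simpa [hw'] using hδ0
      · simpa [hw', h] using hw0 p
    · rcases Finset.mem_insert.1 hp with rfl | hp
      · exact ⟨j, hjI, haj, by rw [hin j haj, hδ]; ring⟩
      · obtain ⟨i, hi, hpi, hs⟩ := hws p hp
        refine ⟨i, hi, hpi, le_antisymm (hcap i hi) ?_⟩
        by_cases hai : a ∈ B i
        · rw [hin i hai, hs]; linarith
        · rw [hout i hai, hs]

/-- A discrete Frostman lemma at scale `ε`: a totally bounded set carries a finite weighted subset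
of `n`-dimensional growth above scale `ε`, whose mass bounds the `n`-dimensional content of a
covering of the set. -/
theorem exists_frostman_weights {Y : Type*} [MetricSpace Y] {E : Set Y} (hE : TotallyBounded E)
    {R : ℝ} (hR : 0 < R) (hdiam : ∀ x ∈ E, ∀ y ∈ E, dist x y ≤ R) (n : ℕ) {ε : ℝ} (hε : 0 < ε) :
    ∃ (P : Finset Y) (w : Y → ℝ), ↑P ⊆ E ∧ (∀ p, 0 ≤ w p) ∧
      (∀ y, ∀ r ≥ ε, ∑ p ∈ P with dist p y ≤ r, w p ≤ 4 ^ n * r ^ n) ∧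
      ∃ u : Finset (Y × ℝ), (∀ i ∈ u, 0 ≤ i.2) ∧ (E ⊆ ⋃ i ∈ u, Metric.closedBall i.1 (6 * i.2)) ∧
        ∑ i ∈ u, i.2 ^ n ≤ ∑ p ∈ P, w p := by
  classical
  obtain ⟨M, hM⟩ : ∃ M : ℕ, R / ε < 2 ^ M := pow_unbounded_of_one_lt _ one_lt_two
  set δ := R / 2 ^ M with hδ
  have hδ0 : 0 < δ := by positivity
  have hδε : δ ≤ ε := by
    rw [hδ, div_le_iff₀ (by positivity)]
    rw [div_lt_iff₀ hε] at hM
    linarith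
  obtain ⟨t, htE, htfin, htc⟩ :=
    totallyBounded_iff_subset.1 hE _ (Metric.dist_mem_uniformity hδ0)
  set P := htfin.toFinset
  have hPE : ∀ p ∈ P, p ∈ E := fun p hp => htE (htfin.mem_toFinset.1 hp)
  set I : Finset (Y × ℝ) := P ×ˢ (Finset.range (M + 1)).image (fun k : ℕ => R / 2 ^ k) with hI
  have hI0 : ∀ i ∈ I, 0 ≤ i.2 ∧ δ ≤ i.2 ∧ i.2 ≤ R := by
    intro i hi
    obtain ⟨-, hi⟩ := Finset.mem_product.1 hi
    obtain ⟨k, hk, hki⟩ := Finset.mem_image.1 hi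
    rw [← hki]
    refine ⟨by positivity, ?_, div_le_self hR.le (one_le_pow₀ one_le_two)⟩
    exact div_le_div_of_nonneg_left hR.le (by positivity)
      (pow_le_pow_right₀ one_le_two (Nat.lt_succ_iff.1 (Finset.mem_range.1 hk)))
  have hmemI : ∀ p ∈ P, ∀ k ≤ M, (p, R / 2 ^ k) ∈ I := fun p hp k hk =>
    Finset.mem_product.2 ⟨hp, Finset.mem_image.2 ⟨k, Finset.mem_range.2 (Nat.lt_succ_iff.2 hk), rfl⟩⟩
  obtain ⟨w, hw0, hwb, hws⟩ := exists_saturated_weights I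
    (fun i => Metric.closedBall i.1 i.2) (fun i => i.2 ^ n) (fun i hi => pow_nonneg (hI0 i hi).1 _) P
    (fun p hp => ⟨_, hmemI p hp 0 (Nat.zero_le _), by simpa using hR.le⟩)
  refine ⟨P, w, fun p hp => hPE p hp, hw0, fun y r hr => ?_, ?_⟩
  · have hr0 : 0 < r := hε.trans_le hr
    rcases (P.filter fun p => dist p y ≤ r).eq_empty_or_nonempty with he | ⟨p₀, hp₀⟩
    · rw [he, Finset.sum_empty]; positivity
    obtain ⟨hp₀, hp₀y⟩ := Finset.mem_filter.1 hp₀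
    -- A dyadic radius comparable to `r` whose ball about `p₀` catches every mass point within `r`
    -- of `y`.
    obtain ⟨k, hk, h1, h2⟩ : ∃ k ≤ M, (2 * r ≤ R / 2 ^ k ∨ R ≤ R / 2 ^ k) ∧ R / 2 ^ k ≤ 4 * r := by
      rcases le_total R (2 * r) with h | h
      · exact ⟨0, Nat.zero_le _, Or.inr (by simp), by simp; linarith⟩
      · obtain ⟨k, hk1, hk2⟩ := exists_nat_pow_near (x := R / (2 * r)) (y := (2 : ℝ))
          ((one_le_div (by positivity)).2 h) one_lt_two
        refine ⟨k, ?_, Or.inl ?_, ?_⟩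
        · have : (2 : ℝ) ^ k < 2 ^ M := by
            refine hk1.trans_lt (lt_of_le_of_lt ?_ hM)
            exact div_le_div_of_nonneg_left hR.le hε (by linarith)
          exact ((pow_lt_pow_iff_right₀ one_lt_two).1 this).le
        · rw [le_div_iff₀ (by positivity)] at hk1 ⊢; linarith
        · rw [div_lt_iff₀ (by positivity), pow_succ] at hk2
          rw [div_le_iff₀ (by positivity)]; linarith
    have hcap := hwb _ (hmemI p₀ hp₀ k hk)
    calc ∑ p ∈ P with dist p y ≤ r, w p
        ≤ ∑ p ∈ P with p ∈ Metric.closedBall p₀ (R / 2 ^ k), w p := by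
          refine Finset.sum_le_sum_of_subset_of_nonneg (fun p hp => ?_) fun p _ _ => hw0 p
          obtain ⟨hp, hpy⟩ := Finset.mem_filter.1 hp
          refine Finset.mem_filter.2 ⟨hp, Metric.mem_closedBall.2 ?_⟩
          rcases h1 with h1 | h1
          · have := dist_triangle_right p p₀ y; linarith
          · exact (hdiam _ (hPE p hp) _ (hPE _ hp₀)).trans h1
      _ ≤ (R / 2 ^ k) ^ n := hcap
      _ ≤ (4 * r) ^ n := pow_le_pow_left₀ (by positivity) h2 n
      _ = _ := mul_pow _ _ _
  · set T : Set (Y × ℝ) := {i | i ∈ I ∧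
      ∑ q ∈ P with q ∈ Metric.closedBall i.1 i.2, w q = i.2 ^ n} with hT
    -- Disjoint saturated balls have total capacity at most the total mass. Vitali enlarges them by
    -- `5`, and the net error `δ` is at most each radius, which makes `6`.
    obtain ⟨u, huT, hud, huc⟩ := Vitali.exists_disjoint_subfamily_covering_enlargement_closedBall T
      (fun i => i.1) (fun i => i.2) R (fun i hi => (hI0 i hi.1).2.2) 5 (by norm_num)
    have hufin : u.Finite := I.finite_toSet.subset fun i hi => (huT hi).1
    refine ⟨hufin.toFinset, fun i hi => (hI0 i (huT (hufin.mem_toFinset.1 hi)).1).1, ?_, ?_⟩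
    · intro x hx
      obtain ⟨p, hp, hxp⟩ := mem_iUnion₂.1 (htc hx)
      have hxp : dist x p < δ := hxp
      obtain ⟨i, hi, hpi, his⟩ := hws p (htfin.mem_toFinset.2 hp)
      obtain ⟨j, hj, hij⟩ := huc i ⟨hi, his⟩
      refine mem_iUnion₂.2 ⟨j, hufin.mem_toFinset.2 hj, Metric.mem_closedBall.2 ?_⟩
      have h1 := Metric.mem_closedBall.1 (hij hpi)
      have h2 := (hI0 j (huT hj).1).2.1
      have := dist_triangle x p j.1
      linarith
    · calc ∑ i ∈ hufin.toFinset, i.2 ^ n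
          = ∑ i ∈ hufin.toFinset, ∑ q ∈ P with q ∈ Metric.closedBall i.1 i.2, w q :=
            Finset.sum_congr rfl fun i hi => (huT (hufin.mem_toFinset.1 hi)).2.symm
        _ = ∑ q ∈ hufin.toFinset.biUnion
              fun i => P.filter fun q => q ∈ Metric.closedBall i.1 i.2, w q := by
            rw [Finset.sum_biUnion]
            intro i hi j hj hij
            refine Finset.disjoint_left.2 fun q hqi hqj => ?_
            exact Set.disjoint_left.1 (hud (hufin.mem_toFinset.1 hi) (hufin.mem_toFinset.1 hj) hij)
              (Finset.mem_filter.1 hqi).2 (Finset.mem_filter.1 hqj).2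
        _ ≤ _ := Finset.sum_le_sum_of_subset_of_nonneg
            (Finset.biUnion_subset.2 fun i _ => Finset.filter_subset _ _) fun p _ _ => hw0 p

-- A small sum of `n`-th powers forces every radius to be small, so vanishing content already gives
-- vanishing measure. The choice `c = (k + 1)⁻ⁿ` makes the diameters tend to zero.
open Filter Topology in
theorem hausdorffMeasure_eq_zero_of_coverings {Y : Type*} [MetricSpace Y] [MeasurableSpace Y]
    [BorelSpace Y] {E : Set Y} {n : ℕ} (hn : n ≠ 0)
    (h : ∀ c > 0, ∃ u : Finset (Y × ℝ), (∀ i ∈ u, 0 ≤ i.2) ∧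
      (E ⊆ ⋃ i ∈ u, Metric.closedBall i.1 (6 * i.2)) ∧ ∑ i ∈ u, i.2 ^ n ≤ c) :
    Measure.hausdorffMeasure (n : ℝ) E = 0 := by
  choose u hu0 huE hus using fun k : ℕ => h ((1 / ((k : ℝ) + 1)) ^ n) (by positivity)
  have hlim : Tendsto (fun k : ℕ => 12 * (1 / ((k : ℝ) + 1))) atTop (𝓝 0) := by
    simpa using tendsto_one_div_add_atTop_nhds_zero_nat.const_mul (12 : ℝ)
  have hlim2 : Tendsto (fun k : ℕ => (12 * (1 / ((k : ℝ) + 1))) ^ n) atTop (𝓝 0) := by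
    simpa [hn] using hlim.pow n
  have hlimE := ENNReal.tendsto_ofReal hlim
  have hlimE2 := ENNReal.tendsto_ofReal hlim2
  rw [ENNReal.ofReal_zero] at hlimE hlimE2
  have hball : ∀ i : Y × ℝ, 0 ≤ i.2 →
      Metric.ediam (Metric.closedBall i.1 (6 * i.2)) ≤ ENNReal.ofReal (12 * i.2) := by
    intro i hi
    refine Metric.ediam_le fun x hx y hy => ?_
    rw [edist_dist]
    refine ENNReal.ofReal_le_ofReal ?_
    have := dist_triangle_right x y i.1
    have := Metric.mem_closedBall.1 hx
    have := Metric.mem_closedBall.1 hy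
    linarith
  have hle := Measure.hausdorffMeasure_le_liminf_sum (ι := fun k => u k) (n : ℝ) E
    (fun k : ℕ => ENNReal.ofReal (12 * (1 / ((k : ℝ) + 1)))) hlimE
    (fun k i => Metric.closedBall i.1.1 (6 * i.1.2))
    (Eventually.of_forall fun k i => (hball _ (hu0 k _ i.2)).trans <|
      ENNReal.ofReal_le_ofReal <| by
        have h1 := (Finset.single_le_sum (fun j hj => pow_nonneg (hu0 k j hj) n) i.2).trans (hus k)
        have := (pow_le_pow_iff_left₀ (hu0 k _ i.2) (by positivity) hn).1 h1
        linarith)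
    (Eventually.of_forall fun k => (huE k).trans fun x hx => by
      obtain ⟨i, hi, hx⟩ := mem_iUnion₂.1 hx
      exact mem_iUnion.2 ⟨⟨i, hi⟩, hx⟩)
  refine le_antisymm (hle.trans ?_) zero_le
  rw [← hlimE2.liminf_eq]
  refine liminf_le_liminf (Eventually.of_forall fun k => ?_)
  calc ∑ i : u k, Metric.ediam (Metric.closedBall i.1.1 (6 * i.1.2)) ^ (n : ℝ)
      ≤ ∑ i : u k, ENNReal.ofReal ((12 * i.1.2) ^ n) := by
        refine Finset.sum_le_sum fun i _ => ?_
        rw [ENNReal.rpow_natCast, ENNReal.ofReal_pow (by have := hu0 k _ i.2; positivity)]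
        exact pow_le_pow_left' (hball _ (hu0 k _ i.2)) n
    _ = ENNReal.ofReal (∑ i ∈ u k, (12 * i.2) ^ n) := by
        rw [ENNReal.ofReal_sum_of_nonneg fun i hi => by have := hu0 k _ hi; positivity]
        exact Finset.sum_coe_sort (u k) fun i => ENNReal.ofReal ((12 * i.2) ^ n)
    _ ≤ _ := by
        refine ENNReal.ofReal_le_ofReal ?_
        simp only [mul_pow, ← Finset.mul_sum]
        exact mul_le_mul_of_nonneg_left (by simpa using hus k) (by positivity)

/-! ### Nets and bounded overlap -/

theorem exists_finset_net {Y : Type*} [PseudoMetricSpace Y] (X : Finset Y) {ρ : ℝ} (hρ : 0 < ρ) :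
    ∃ (N : Finset Y) (c : Y → Y), N ⊆ X ∧ (∀ a ∈ N, ∀ b ∈ N, a ≠ b → ρ < dist a b) ∧
      ∀ x ∈ X, c x ∈ N ∧ dist x (c x) ≤ ρ := by
  classical
  suffices ∃ N : Finset Y, N ⊆ X ∧ (∀ a ∈ N, ∀ b ∈ N, a ≠ b → ρ < dist a b) ∧
      ∀ x ∈ X, ∃ c ∈ N, dist x c ≤ ρ by
    obtain ⟨N, h1, h2, h3⟩ := this
    refine ⟨N, fun x => if h : x ∈ X then (h3 x h).choose else x, h1, h2, fun x hx => ?_⟩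
    simp only [hx, dif_pos]
    exact (h3 x hx).choose_spec
  induction X using Finset.induction_on with
  | empty => exact ⟨∅, by simp⟩
  | insert a X ha ih =>
    obtain ⟨N, h1, h2, h3⟩ := ih
    by_cases h : ∃ c ∈ N, dist a c ≤ ρ
    · refine ⟨N, h1.trans (Finset.subset_insert _ _), h2, fun x hx => ?_⟩
      rcases Finset.mem_insert.1 hx with rfl | hx
      · exact h
      · exact h3 x hx
    · push Not at h
      refine ⟨insert a N, Finset.insert_subset_insert _ h1, ?_, fun x hx => ?_⟩
      · intro b hb c hc hbc
        rcases Finset.mem_insert.1 hb with rfl | hb' <;> rcases Finset.mem_insert.1 hc with rfl | hc'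
        · exact absurd rfl hbc
        · exact h c hc'
        · rw [dist_comm]; exact h b hb'
        · exact h2 b hb' c hc' hbc
      · rcases Finset.mem_insert.1 hx with rfl | hx
        · exact ⟨x, Finset.mem_insert_self _ _, by simpa using hρ.le⟩
        · obtain ⟨c, hc, hxc⟩ := h3 x hx
          exact ⟨c, Finset.mem_insert_of_mem hc, hxc⟩

/-- After rescaling by `ρ⁻¹`, a ball of radius `1 / 2` contains at most one point, and a fixed
finite number of such balls covers radius `L`. -/
theorem exists_card_le_of_separated (V : Type*) [NormedAddCommGroup V] [NormedSpace ℝ V]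
    [ProperSpace V] (L : ℝ) : ∃ K : ℕ, ∀ ρ > 0, ∀ (w : V) (N : Finset V),
      (∀ a ∈ N, ∀ b ∈ N, a ≠ b → ρ < dist a b) → (∀ a ∈ N, dist a w ≤ L * ρ) → N.card ≤ K := by
  obtain ⟨t, -, htfin, ht⟩ := (isCompact_closedBall (0 : V) L).finite_cover_balls
    (e := 1 / 2) (by norm_num)
  refine ⟨htfin.toFinset.card, fun ρ hρ w N hsep hN => ?_⟩
  have hex : ∀ a ∈ N, ∃ q ∈ t, dist (ρ⁻¹ • (a - w)) q < 1 / 2 := by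
    intro a ha
    have : ρ⁻¹ • (a - w) ∈ Metric.closedBall (0 : V) L := by
      rw [mem_closedBall_zero_iff, norm_smul, norm_inv, Real.norm_of_nonneg hρ.le, ← dist_eq_norm,
        inv_mul_le_iff₀ hρ]
      linarith [hN a ha]
    obtain ⟨q, hq, h⟩ := mem_iUnion₂.1 (ht this)
    exact ⟨q, hq, h⟩
  choose! g hgt hgd using hex
  refine Finset.card_le_card_of_injOn g (fun a ha => htfin.mem_toFinset.2 (hgt a ha)) ?_
  intro a ha b hb hab
  by_contra hne
  have h1 := hgd a ha
  have h2 := hgd b hb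
  rw [← hab] at h2
  have h3 := dist_triangle_right (ρ⁻¹ • (a - w)) (ρ⁻¹ • (b - w)) (g a)
  have h4 : dist (ρ⁻¹ • (a - w)) (ρ⁻¹ • (b - w)) = ρ⁻¹ * dist a b := by
    rw [dist_smul₀, dist_sub_right, norm_inv, Real.norm_of_nonneg hρ.le]
  have h5 : 1 < ρ⁻¹ * dist a b := by
    rw [lt_inv_mul_iff₀ hρ]
    linarith [hsep a ha b hb hne]
  linarith

theorem sum_measure_le_of_card_le {α κ : Type*} [MeasurableSpace α] (μ : Measure α)
    (t : Finset κ) (S : κ → Set α) (hS : ∀ k ∈ t, MeasurableSet (S k)) {Ω : Set α}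
    (hΩ : MeasurableSet Ω) (hSΩ : ∀ k ∈ t, S k ⊆ Ω) (K : ℕ)
    (hK : ∀ x, ∀ t' ⊆ t, (∀ k ∈ t', x ∈ S k) → t'.card ≤ K) :
    ∑ k ∈ t, μ (S k) ≤ K * μ Ω := by
  classical
  calc ∑ k ∈ t, μ (S k) = ∑ k ∈ t, ∫⁻ x, (S k).indicator 1 x ∂μ :=
        Finset.sum_congr rfl fun k hk => (lintegral_indicator_one (hS k hk)).symm
    _ = ∫⁻ x, ∑ k ∈ t, (S k).indicator 1 x ∂μ :=
        (lintegral_finsetSum _ fun k hk => measurable_one.indicator (hS k hk)).symm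
    _ ≤ ∫⁻ x, Ω.indicator (fun _ => (K : ℝ≥0∞)) x ∂μ := by
        refine lintegral_mono fun x => ?_
        by_cases hx : x ∈ Ω
        · simp only [hx, indicator_of_mem]
          calc ∑ k ∈ t, (S k).indicator (1 : α → ℝ≥0∞) x
              = ∑ k ∈ t, if x ∈ S k then 1 else 0 := by simp [indicator_apply]
            _ = ((t.filter fun k => x ∈ S k).card : ℝ≥0∞) := by rw [Finset.sum_boole]
            _ ≤ K := Nat.cast_le.2 (hK x _ (Finset.filter_subset _ _)
                (fun k hk => (Finset.mem_filter.1 hk).2))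
        · refine (Finset.sum_eq_zero fun k hk => ?_).trans_le zero_le
          exact indicator_of_notMem (fun h => hx (hSΩ k hk h)) _
    _ = K * μ Ω := lintegral_indicator_const hΩ _

/-! ### Smooth ball averages and their variation in terms of energy -/

/-- A smooth probability density supported in the closed unit ball. -/
noncomputable def unitBump (n : ℕ) : EuclideanSpace ℝ (Fin n) → ℝ :=
  ContDiffBump.normed (⟨1 / 2, 1, by norm_num, by norm_num⟩ :
    ContDiffBump (0 : EuclideanSpace ℝ (Fin n))) volume

theorem contDiff_unitBump (n : ℕ) : ContDiff ℝ ∞ (unitBump n) := ContDiffBump.contDiff_normed _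

theorem unitBump_nonneg (n : ℕ) (x : EuclideanSpace ℝ (Fin n)) : 0 ≤ unitBump n x :=
  ContDiffBump.nonneg_normed _ _

theorem integral_unitBump (n : ℕ) : ∫ x, unitBump n x = 1 := ContDiffBump.integral_normed _

theorem unitBump_eq_zero {n : ℕ} {x : EuclideanSpace ℝ (Fin n)} (hx : 1 < ‖x‖) :
    unitBump n x = 0 := by
  by_contra h
  have : x ∈ Function.support (unitBump n) := h
  rw [unitBump, ContDiffBump.support_normed_eq, mem_ball_zero_iff] at this
  linarith

theorem exists_unitBump_le (n : ℕ) : ∃ M, 0 ≤ M ∧ ∀ x, unitBump n x ≤ M :=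
  ⟨1 / volume.real (Metric.closedBall (0 : EuclideanSpace ℝ (Fin n)) (1 / 2)), by positivity,
    fun x => ContDiffBump.normed_le_div_measure_closedBall_rIn
      (⟨1 / 2, 1, by norm_num, by norm_num⟩ : ContDiffBump (0 : EuclideanSpace ℝ (Fin n)))
      volume x⟩

/-- The bump function `unitBump` moved to the ball of centre `z` and radius `h`. -/
noncomputable def ballKernel {n : ℕ} (z : EuclideanSpace ℝ (Fin n)) (h : ℝ)
    (w : EuclideanSpace ℝ (Fin n)) : ℝ :=
  (h⁻¹) ^ n * unitBump n (h⁻¹ • (w - z))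

theorem continuous_ballKernel {n : ℕ} (z : EuclideanSpace ℝ (Fin n)) (h : ℝ) :
    Continuous (ballKernel z h) := by
  have := (contDiff_unitBump n).continuous
  unfold ballKernel
  fun_prop

theorem ballKernel_eq_zero {n : ℕ} {z w : EuclideanSpace ℝ (Fin n)} {h : ℝ} (hh : 0 < h)
    (hw : w ∉ Metric.closedBall z h) : ballKernel z h w = 0 := by
  rw [ballKernel, unitBump_eq_zero, mul_zero]
  rw [norm_smul, norm_inv, Real.norm_of_nonneg hh.le, ← dist_eq_norm, lt_inv_mul_iff₀ hh]
  simpa using hw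

theorem ballKernel_nonneg {n : ℕ} (z w : EuclideanSpace ℝ (Fin n)) {h : ℝ} (hh : 0 < h) :
    0 ≤ ballKernel z h w := mul_nonneg (by positivity) (unitBump_nonneg n _)

theorem integral_ballKernel {n : ℕ} (z : EuclideanSpace ℝ (Fin n)) {h : ℝ} (hh : 0 < h) :
    ∫ w, ballKernel z h w = 1 := by
  unfold ballKernel
  rw [integral_const_mul, integral_sub_right_eq_self (fun w => unitBump n (h⁻¹ • w)) z,
    Measure.integral_comp_inv_smul, integral_unitBump, finrank_euclideanSpace_fin,
    abs_of_pos (by positivity), smul_eq_mul, mul_one, ← mul_pow, inv_mul_cancel₀ hh.ne', one_pow]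

theorem setIntegral_ballKernel {n : ℕ} {z : EuclideanSpace ℝ (Fin n)} {h : ℝ} (hh : 0 < h)
    {Ω : Set (EuclideanSpace ℝ (Fin n))} (hΩ : Metric.closedBall z h ⊆ Ω) :
    ∫ w in Ω, ballKernel z h w = 1 := by
  rw [setIntegral_eq_integral_of_forall_compl_eq_zero, integral_ballKernel z hh]
  exact fun w hw => ballKernel_eq_zero hh fun h' => hw (hΩ h')

/-- The average of `f` over the ball of centre `z` and radius `h` with respect to `ballKernel`. -/
noncomputable def ballAverage {n m : ℕ}
    (f : EuclideanSpace ℝ (Fin n) → EuclideanSpace ℝ (Fin m))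
    (z : EuclideanSpace ℝ (Fin n)) (h : ℝ) : EuclideanSpace ℝ (Fin m) :=
  ∫ w in Metric.ball 0 1, ballKernel z h w • f w

theorem integrableOn_smul_of_continuous {n m : ℕ}
    {f : EuclideanSpace ℝ (Fin n) → EuclideanSpace ℝ (Fin m)}
    (hf : ContinuousOn f (Metric.closedBall 0 1)) {k : EuclideanSpace ℝ (Fin n) → ℝ}
    (hk : Continuous k) : IntegrableOn (fun w => k w • f w) (Metric.ball 0 1) :=
  ((hk.continuousOn.smul hf).integrableOn_compact (isCompact_closedBall _ _)).mono_set
    Metric.ball_subset_closedBall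

theorem norm_ballAverage_sub_le {n m : ℕ}
    {f : EuclideanSpace ℝ (Fin n) → EuclideanSpace ℝ (Fin m)}
    (hf : ContinuousOn f (Metric.closedBall 0 1)) {z : EuclideanSpace ℝ (Fin n)} {h : ℝ}
    (hh : 0 < h) (hz : Metric.closedBall z h ⊆ Metric.ball 0 1) {y : EuclideanSpace ℝ (Fin m)}
    {D : ℝ} (hD : ∀ w ∈ Metric.closedBall z h, ‖f w - y‖ ≤ D) :
    ‖ballAverage f z h - y‖ ≤ D := by
  have h1 := setIntegral_ballKernel hh hz
  have hint : IntegrableOn (ballKernel z h) (Metric.ball 0 1) :=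
    ((continuous_ballKernel z h).continuousOn.integrableOn_compact
      (isCompact_closedBall 0 1)).mono_set Metric.ball_subset_closedBall
  have e : ballAverage f z h - y = ∫ w in Metric.ball 0 1, ballKernel z h w • (f w - y) := by
    simp only [smul_sub]
    rw [integral_sub (integrableOn_smul_of_continuous hf (continuous_ballKernel z h))
      (hint.smul_const y), integral_smul_const, h1, one_smul]
    rfl
  rw [e]
  calc _ ≤ ∫ w in Metric.ball 0 1, ballKernel z h w * D := by
        refine norm_integral_le_of_norm_le (hint.mul_const D) (Filter.Eventually.of_forall fun w => ?_)
        rw [norm_smul, Real.norm_of_nonneg (ballKernel_nonneg z w hh)]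
        by_cases hw : w ∈ Metric.closedBall z h
        · exact mul_le_mul_of_nonneg_left (hD w hw) (ballKernel_nonneg z w hh)
        · simp [ballKernel_eq_zero hh hw]
    _ = D := by rw [integral_mul_const, h1, one_mul]

/-- The `s`-derivative, up to sign, of the kernel of the ball moving with velocity `v` and growing
at rate `k`. -/
noncomputable def ballKernelDiv {n : ℕ} (z : EuclideanSpace ℝ (Fin n)) (h : ℝ)
    (v : EuclideanSpace ℝ (Fin n)) (k : ℝ) (w : EuclideanSpace ℝ (Fin n)) : ℝ :=
  (h⁻¹) ^ (n + 1) * (n * k * unitBump n (h⁻¹ • (w - z))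
    + fderiv ℝ (unitBump n) (h⁻¹ • (w - z)) (v + k • (h⁻¹ • (w - z))))

theorem hasDerivAt_ballKernel {n : ℕ} (z v w : EuclideanSpace ℝ (Fin n)) (h k s : ℝ)
    (hh : h + s * k ≠ 0) :
    HasDerivAt (fun s : ℝ => ballKernel (z + s • v) (h + s * k) w)
      (-ballKernelDiv (z + s • v) (h + s * k) v k w) s := by
  have d1 : HasDerivAt (fun s : ℝ => h + s * k) k s := by
    simpa using ((hasDerivAt_id s).mul_const k).const_add h
  have d2 := d1.fun_inv hh
  have d3 : HasDerivAt (fun s : ℝ => w - (z + s • v)) (-v) s := by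
    simpa using (((hasDerivAt_id s).smul_const v).const_add z).const_sub w
  have d4 := d2.fun_smul d3
  have hφ : DifferentiableAt ℝ (unitBump n) ((h + s * k)⁻¹ • (w - (z + s • v))) :=
    (contDiff_unitBump n).differentiable (by simp) _
  have d5 := hφ.hasFDerivAt.comp_hasDerivAt s d4
  have d6 := (d2.fun_pow n).mul d5
  refine d6.congr_deriv ?_
  have e : -k / (h + s * k) ^ 2 = -k * ((h + s * k)⁻¹) ^ 2 := by rw [inv_pow]; rfl
  simp only [ballKernelDiv, Function.comp, map_add, map_smul, map_neg, smul_eq_mul, e]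
  set a := (h + s * k)⁻¹
  -- The derivative of the power involves the truncated exponent `n - 1`.
  cases n with
  | zero => simp; ring
  | succ p => push_cast; ring

/-- The `i`-th component of the flux whose divergence is `ballKernelDiv`. -/
noncomputable def ballFlux {n : ℕ} (z : EuclideanSpace ℝ (Fin n)) (h : ℝ)
    (v : EuclideanSpace ℝ (Fin n)) (k : ℝ) (i : Fin n) (w : EuclideanSpace ℝ (Fin n)) : ℝ :=
  ballKernel z h w * (v i + k * (h⁻¹ * (w i - z i)))

theorem contDiff_ballFlux {n : ℕ} (z : EuclideanSpace ℝ (Fin n)) (h : ℝ)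
    (v : EuclideanSpace ℝ (Fin n)) (k : ℝ) (i : Fin n) : ContDiff ℝ ∞ (ballFlux z h v k i) := by
  have h1 := contDiff_unitBump n
  have h2 : ContDiff ℝ ∞ fun w : EuclideanSpace ℝ (Fin n) => w i :=
    (EuclideanSpace.proj (𝕜 := ℝ) i).contDiff
  have h3 : ContDiff ℝ ∞ fun w : EuclideanSpace ℝ (Fin n) => unitBump n (h⁻¹ • (w - z)) :=
    h1.comp (by fun_prop)
  unfold ballFlux ballKernel
  fun_prop

theorem tsupport_ballFlux_subset {n : ℕ} (z : EuclideanSpace ℝ (Fin n)) {h : ℝ} (hh : 0 < h)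
    (v : EuclideanSpace ℝ (Fin n)) (k : ℝ) (i : Fin n) :
    tsupport (ballFlux z h v k i) ⊆ Metric.closedBall z h := by
  refine closure_minimal (fun w hw => ?_) Metric.isClosed_closedBall
  by_contra h'
  exact hw (by rw [ballFlux, ballKernel_eq_zero hh h', zero_mul])

theorem fderiv_ballFlux {n : ℕ} (z : EuclideanSpace ℝ (Fin n)) (h : ℝ)
    (v : EuclideanSpace ℝ (Fin n)) (k : ℝ) (i : Fin n) (w : EuclideanSpace ℝ (Fin n)) :
    fderiv ℝ (ballFlux z h v k i) w (EuclideanSpace.single i 1) =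
      (h⁻¹) ^ (n + 1) * (k * unitBump n (h⁻¹ • (w - z))
        + (v i + k * (h⁻¹ * (w i - z i))) *
          fderiv ℝ (unitBump n) (h⁻¹ • (w - z)) (EuclideanSpace.single i 1)) := by
  set e : EuclideanSpace ℝ (Fin n) := EuclideanSpace.single i 1 with he
  have h1 : HasLineDerivAt ℝ (ballFlux z h v k i) (fderiv ℝ (ballFlux z h v k i) w e) w e :=
    (((contDiff_ballFlux z h v k i).differentiable (by simp)) w).hasFDerivAt.hasLineDerivAt e
  refine HasDerivAt.unique h1 ?_
  have d3 : HasDerivAt (fun t : ℝ => w + t • e - z) e 0 := by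
    simpa using (((hasDerivAt_id (0 : ℝ)).smul_const e).const_add w).sub_const z
  have d4 := d3.const_smul (h⁻¹)
  have hφ : DifferentiableAt ℝ (unitBump n) (h⁻¹ • (w + (0 : ℝ) • e - z)) :=
    (contDiff_unitBump n).differentiable (by simp) _
  have d5 := (hφ.hasFDerivAt.comp_hasDerivAt 0 d4).const_mul ((h⁻¹) ^ n)
  have d6 : HasDerivAt (fun t : ℝ => v i + k * (h⁻¹ * ((w + t • e) i - z i))) (k * h⁻¹) 0 := by
    have : HasDerivAt (fun t : ℝ => w i + t - z i) 1 0 := by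
      simpa using ((hasDerivAt_id (0 : ℝ)).const_add (w i)).sub_const (z i)
    simpa [he] using ((this.const_mul (h⁻¹)).const_mul k).const_add (v i)
  refine (d5.mul d6).congr_deriv ?_
  simp only [Function.comp, Pi.smul_apply, zero_smul, add_zero, map_smul, smul_eq_mul]
  ring

/-- The continuity equation: the kernel is transported by the velocity field `v + k (w - z) / h`. -/
theorem sum_fderiv_ballFlux {n : ℕ} (z : EuclideanSpace ℝ (Fin n)) (h : ℝ)
    (v : EuclideanSpace ℝ (Fin n)) (k : ℝ) (w : EuclideanSpace ℝ (Fin n)) :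
    ∑ i, fderiv ℝ (ballFlux z h v k i) w (EuclideanSpace.single i 1) = ballKernelDiv z h v k w := by
  have hV : v + k • (h⁻¹ • (w - z)) = ∑ i, (v i + k * (h⁻¹ * (w i - z i))) •
      (EuclideanSpace.single i 1 : EuclideanSpace ℝ (Fin n)) := by
    ext j
    simp [Finset.sum_apply, Pi.single_apply]
  simp only [fderiv_ballFlux, ballKernelDiv]
  rw [← Finset.mul_sum, Finset.sum_add_distrib, hV, map_sum]
  simp only [map_smul, smul_eq_mul, Finset.sum_const, Finset.card_univ, Fintype.card_fin,
    nsmul_eq_mul, mul_assoc]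

theorem integral_norm_le_rpow_lintegral {α F : Type*} [MeasurableSpace α] [NormedAddCommGroup F]
    {ν : Measure α} [IsFiniteMeasure ν] {g : α → F} {n : ℕ} (hn : 1 ≤ n) (hg : MemLp g n ν) :
    ∫ x, ‖g x‖ ∂ν ≤
      (∫⁻ x, ‖g x‖ₑ ^ n ∂ν).toReal ^ (1 / n : ℝ) * ν.real univ ^ (1 - 1 / n : ℝ) := by
  have h1 := eLpNorm_le_eLpNorm_mul_rpow_measure_univ (μ := ν) (p := 1) (q := n)
    (by exact_mod_cast hn) hg.aestronglyMeasurable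
  have hn0 : (n : ℝ≥0∞) ≠ 0 := by exact_mod_cast (by omega : n ≠ 0)
  have h2 : eLpNorm g n ν = (∫⁻ x, ‖g x‖ₑ ^ n ∂ν) ^ (1 / n : ℝ) := by
    rw [eLpNorm_eq_lintegral_rpow_enorm_toReal hn0 (ENNReal.natCast_ne_top n)]
    simp
  have hp : (0 : ℝ) ≤ 1 - 1 / n := by
    rw [sub_nonneg, div_le_one (by positivity)]
    exact_mod_cast hn
  have h3 : eLpNorm g n ν * ν univ ^ (1 - 1 / n : ℝ) ≠ ⊤ :=
    ENNReal.mul_ne_top hg.eLpNorm_ne_top (ENNReal.rpow_ne_top_of_nonneg hp (measure_ne_top _ _))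
  have h4 := ENNReal.toReal_mono h3 (by simpa using h1)
  rw [integral_norm_eq_lintegral_enorm hg.aestronglyMeasurable, ← eLpNorm_one_eq_lintegral_enorm]
  rwa [h2, ENNReal.toReal_mul, ← ENNReal.toReal_rpow, ← ENNReal.toReal_rpow] at h4

/-- The measure on the unit ball with density `∑ i, ‖g i‖ ^ n`. -/
noncomputable def energyMeasure {n m : ℕ}
    (g : Fin n → EuclideanSpace ℝ (Fin n) → EuclideanSpace ℝ (Fin m)) :
    Measure (EuclideanSpace ℝ (Fin n)) :=
  ∑ i, (volume.restrict (Metric.ball 0 1)).withDensity fun x => ‖g i x‖ₑ ^ n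

theorem lintegral_enorm_pow_lt_top {n m : ℕ} (hn : 1 ≤ n)
    {g : EuclideanSpace ℝ (Fin n) → EuclideanSpace ℝ (Fin m)}
    {ν : Measure (EuclideanSpace ℝ (Fin n))} (hg : MemLp g n ν) :
    ∫⁻ x, ‖g x‖ₑ ^ n ∂ν < ⊤ := by
  have := lintegral_rpow_enorm_lt_top_of_eLpNorm_lt_top
    (by exact_mod_cast (by omega : n ≠ 0)) (ENNReal.natCast_ne_top n) hg.eLpNorm_lt_top
  simpa using this

theorem isFiniteMeasure_energyMeasure {n m : ℕ} (hn : 1 ≤ n)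
    {g : Fin n → EuclideanSpace ℝ (Fin n) → EuclideanSpace ℝ (Fin m)}
    (hg : ∀ i, MemLp (g i) n (volume.restrict (Metric.ball 0 1))) :
    IsFiniteMeasure (energyMeasure g) := by
  have : ∀ i, IsFiniteMeasure ((volume.restrict (Metric.ball 0 1)).withDensity
      fun x => ‖g i x‖ₑ ^ n) := fun i =>
    isFiniteMeasure_withDensity (lintegral_enorm_pow_lt_top hn (hg i)).ne
  unfold energyMeasure
  infer_instance

/-- Hölder's inequality; the volume factor to the power `1 - 1 / n` scales like `h ^ (n - 1)`. -/
theorem setIntegral_norm_le_energyMeasure {n m : ℕ} (hn : 1 ≤ n)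
    {g : Fin n → EuclideanSpace ℝ (Fin n) → EuclideanSpace ℝ (Fin m)}
    (hg : ∀ i, MemLp (g i) n (volume.restrict (Metric.ball 0 1))) (i : Fin n)
    {z : EuclideanSpace ℝ (Fin n)} {h : ℝ} (hh : 0 < h)
    {S : Set (EuclideanSpace ℝ (Fin n))} (hzS : Metric.closedBall z h ⊆ S)
    (hz : Metric.closedBall z h ⊆ Metric.ball 0 1) :
    ∫ x in Metric.closedBall z h, ‖g i x‖ ≤
      (energyMeasure g).real S ^ (1 / n : ℝ) * (h ^ (n - 1) *
        volume.real (Metric.closedBall (0 : EuclideanSpace ℝ (Fin n)) 1) ^ (1 - 1 / n : ℝ)) := by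
  have := isFiniteMeasure_energyMeasure hn hg
  have : IsFiniteMeasure (volume.restrict (Metric.closedBall z h)) :=
    isFiniteMeasure_restrict.2 measure_closedBall_lt_top.ne
  have hg' : MemLp (g i) n (volume.restrict (Metric.closedBall z h)) :=
    (hg i).mono_measure (Measure.restrict_mono hz le_rfl)
  refine (integral_norm_le_rpow_lintegral hn hg').trans ?_
  have hvol : (volume.restrict (Metric.closedBall z h)).real univ ^ (1 - 1 / n : ℝ) =
      h ^ (n - 1) *
        volume.real (Metric.closedBall (0 : EuclideanSpace ℝ (Fin n)) 1) ^ (1 - 1 / n : ℝ) := by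
    rw [measureReal_restrict_apply_univ, Measure.addHaar_real_closedBall' _ _ hh.le,
      finrank_euclideanSpace_fin, Real.mul_rpow (by positivity) measureReal_nonneg]
    congr 1
    rw [← Real.rpow_natCast, ← Real.rpow_natCast, ← Real.rpow_mul hh.le]
    congr 1
    have : (n : ℝ) ≠ 0 := by exact_mod_cast (by omega : n ≠ 0)
    rw [Nat.cast_sub hn]
    field_simp
    simp
  rw [hvol]
  refine mul_le_mul_of_nonneg_right ?_ (by positivity)
  refine Real.rpow_le_rpow ENNReal.toReal_nonneg ?_ (by positivity)
  refine ENNReal.toReal_mono (measure_ne_top _ _) ?_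
  calc ∫⁻ x in Metric.closedBall z h, ‖g i x‖ₑ ^ n
      = ∫⁻ x in Metric.closedBall z h, ‖g i x‖ₑ ^ n ∂(volume.restrict (Metric.ball 0 1)) := by
        rw [Measure.restrict_restrict_of_subset hz]
    _ = ((volume.restrict (Metric.ball 0 1)).withDensity fun x => ‖g i x‖ₑ ^ n)
          (Metric.closedBall z h) := (withDensity_apply _ measurableSet_closedBall).symm
    _ ≤ energyMeasure g (Metric.closedBall z h) := by
        rw [energyMeasure, Measure.finsetSum_apply]
        exact Finset.single_le_sum (f := fun i => ((volume.restrict (Metric.ball 0 1)).withDensity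
          fun x => ‖g i x‖ₑ ^ n) (Metric.closedBall z h)) (fun _ _ => zero_le) (Finset.mem_univ i)
    _ ≤ _ := measure_mono hzS

open Filter Topology in
theorem hasDerivAt_ballAverage {n m : ℕ}
    {f : EuclideanSpace ℝ (Fin n) → EuclideanSpace ℝ (Fin m)}
    (hf : ContinuousOn f (Metric.closedBall 0 1)) (z v : EuclideanSpace ℝ (Fin n)) {h k s : ℝ}
    (hh : 0 < h + s * k) :
    HasDerivAt (fun s : ℝ => ballAverage f (z + s • v) (h + s * k))
      (∫ w in Metric.ball 0 1, (-ballKernelDiv (z + s • v) (h + s * k) v k w) • f w) s := by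
  have hopen : IsOpen {s : ℝ | 0 < h + s * k} := isOpen_lt continuous_const (by fun_prop)
  obtain ⟨δ, hδ, hδs⟩ := Metric.nhds_basis_closedBall.mem_iff.1 (hopen.mem_nhds hh)
  have hφ := (contDiff_unitBump n).continuous
  have hφ' := (contDiff_unitBump n).continuous_fderiv (by simp)
  have hcont : ContinuousOn (fun q : ℝ × EuclideanSpace ℝ (Fin n) =>
      (-ballKernelDiv (z + q.1 • v) (h + q.1 * k) v k q.2) • f q.2)
      (Metric.closedBall s δ ×ˢ Metric.closedBall 0 1) := by
    have hinv : ContinuousOn (fun q : ℝ × EuclideanSpace ℝ (Fin n) => (h + q.1 * k)⁻¹)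
        (Metric.closedBall s δ ×ˢ Metric.closedBall 0 1) :=
      ContinuousOn.inv₀ (by fun_prop) fun q hq => (hδs hq.1).ne'
    have hξ : ContinuousOn (fun q : ℝ × EuclideanSpace ℝ (Fin n) =>
        (h + q.1 * k)⁻¹ • (q.2 - (z + q.1 • v)))
        (Metric.closedBall s δ ×ˢ Metric.closedBall 0 1) := hinv.smul (by fun_prop)
    have hf' : ContinuousOn (fun q : ℝ × EuclideanSpace ℝ (Fin n) => f q.2)
        (Metric.closedBall s δ ×ˢ Metric.closedBall 0 1) :=
      hf.comp continuousOn_snd fun q hq => hq.2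
    refine ContinuousOn.fun_smul (ContinuousOn.fun_neg ?_) hf'
    unfold ballKernelDiv
    refine (hinv.pow _).mul (ContinuousOn.add (continuousOn_const.mul (hφ.comp_continuousOn hξ)) ?_)
    exact (hφ'.comp_continuousOn hξ).clm_apply (continuousOn_const.add (hξ.const_smul k))
  obtain ⟨D, hD⟩ := ((isCompact_closedBall s δ).prod
    (isCompact_closedBall (0 : EuclideanSpace ℝ (Fin n)) 1)).exists_bound_of_continuousOn hcont
  have hdivc : Continuous (ballKernelDiv (z + s • v) (h + s * k) v k) := by
    unfold ballKernelDiv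
    fun_prop
  have : IsFiniteMeasure (volume.restrict (Metric.ball (0 : EuclideanSpace ℝ (Fin n)) 1)) :=
    isFiniteMeasure_restrict.2 measure_ball_lt_top.ne
  refine (hasDerivAt_integral_of_dominated_loc_of_deriv_le
    (F := fun s w => ballKernel (z + s • v) (h + s * k) w • f w)
    (F' := fun s w => (-ballKernelDiv (z + s • v) (h + s * k) v k w) • f w)
    (bound := fun _ => D) (Metric.closedBall_mem_nhds s hδ)
    (Eventually.of_forall fun t => (integrableOn_smul_of_continuous hf
      (continuous_ballKernel _ _)).aestronglyMeasurable)
    (integrableOn_smul_of_continuous hf (continuous_ballKernel _ _))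
    (integrableOn_smul_of_continuous hf hdivc.neg).aestronglyMeasurable ?_
    (integrable_const D) ?_).2
  · filter_upwards [ae_restrict_mem Metric.isOpen_ball.measurableSet] with w hw t ht
    exact hD (t, w) ⟨ht, Metric.ball_subset_closedBall hw⟩
  · exact Eventually.of_forall fun w t ht =>
      (hasDerivAt_ballKernel z v w h k t (hδs ht).ne').smul_const (f w)

/-- Integration by parts with the flux components as test functions. -/
theorem integral_ballKernelDiv_smul {n m : ℕ}
    {f : EuclideanSpace ℝ (Fin n) → EuclideanSpace ℝ (Fin m)}
    (hf : ContinuousOn f (Metric.closedBall 0 1))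
    {g : Fin n → EuclideanSpace ℝ (Fin n) → EuclideanSpace ℝ (Fin m)}
    (hfg : ∀ i, IsWeakPartialDeriv (Metric.ball 0 1) i f (g i))
    (z v : EuclideanSpace ℝ (Fin n)) {h k : ℝ} (hh : 0 < h)
    (hz : Metric.closedBall z h ⊆ Metric.ball 0 1) :
    ∫ w in Metric.ball 0 1, (-ballKernelDiv z h v k w) • f w =
      ∑ i, ∫ w in Metric.ball 0 1, ballFlux z h v k i w • g i w := by
  have h1 : ∀ i, ∫ w in Metric.ball 0 1, ballFlux z h v k i w • g i w =
      -∫ w in Metric.ball 0 1,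
        (fderiv ℝ (ballFlux z h v k i) w (EuclideanSpace.single i 1)) • f w := by
    intro i
    have hsub := tsupport_ballFlux_subset z hh v k i
    rw [hfg i _ (contDiff_ballFlux z h v k i)
      ((isCompact_closedBall z h).of_isClosed_subset (isClosed_tsupport _) hsub) (hsub.trans hz),
      neg_neg]
  simp only [h1, Finset.sum_neg_distrib, neg_smul, integral_neg]
  rw [← integral_finsetSum _ fun i _ => ?_]
  · simp only [← sum_fderiv_ballFlux, Finset.sum_smul]
  · exact integrableOn_smul_of_continuous hf
      (((contDiff_ballFlux z h v k i).continuous_fderiv (by simp)).clm_apply continuous_const)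

theorem abs_ballFlux_le {n : ℕ} {M : ℝ} (hM : ∀ x, unitBump n x ≤ M)
    (z v : EuclideanSpace ℝ (Fin n)) {h k : ℝ} (hh : 0 < h) (i : Fin n)
    {w : EuclideanSpace ℝ (Fin n)} (hw : w ∈ Metric.closedBall z h) :
    |ballFlux z h v k i w| ≤ (h⁻¹) ^ n * M * (‖v‖ + |k|) := by
  have hM0 : 0 ≤ M := (unitBump_nonneg n 0).trans (hM 0)
  rw [ballFlux, abs_mul, abs_of_nonneg (ballKernel_nonneg z w hh), ballKernel]
  have h1 : |v i| ≤ ‖v‖ := by simpa using PiLp.norm_apply_le v i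
  have h2 : |w i - z i| ≤ h := by
    have := PiLp.norm_apply_le (w - z) i
    rw [← dist_eq_norm] at this
    exact (by simpa using this : |w i - z i| ≤ dist w z).trans (Metric.mem_closedBall.1 hw)
  have h3 : |h⁻¹ * (w i - z i)| ≤ 1 := by
    rw [abs_mul, abs_of_pos (inv_pos.2 hh), inv_mul_le_iff₀ hh, mul_one]
    exact h2
  have h4 : |v i + k * (h⁻¹ * (w i - z i))| ≤ ‖v‖ + |k| := by
    refine (abs_add_le _ _).trans (add_le_add h1 ?_)
    rw [abs_mul]
    exact mul_le_of_le_one_right (abs_nonneg _) h3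
  gcongr
  exact hM _

/-- Moving one ball to the other, the average changes at a rate at most about `h⁻ⁿ * (L * h) * ∫
|∂ᵢf|` over the current ball, and Hölder gives `h ^ (n - 1)` times the root of the energy. The
powers of `h` cancel: the exponent `n` is scale invariant. -/
theorem exists_norm_ballAverage_sub_le (n m : ℕ) (hn : 1 ≤ n) : ∃ C, 0 ≤ C ∧
    ∀ (f : EuclideanSpace ℝ (Fin n) → EuclideanSpace ℝ (Fin m))
      (g : Fin n → EuclideanSpace ℝ (Fin n) → EuclideanSpace ℝ (Fin m)),
      ContinuousOn f (Metric.closedBall 0 1) →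
      (∀ i, MemLp (g i) n (volume.restrict (Metric.ball 0 1))) →
      (∀ i, IsWeakPartialDeriv (Metric.ball 0 1) i f (g i)) →
      ∀ (z₀ z₁ : EuclideanSpace ℝ (Fin n)) (h₀ h₁ L : ℝ), 0 < h₀ → 0 < h₁ →
      ‖z₁ - z₀‖ + |h₁ - h₀| ≤ L * min h₀ h₁ → ∀ S : Set (EuclideanSpace ℝ (Fin n)),
      (∀ s ∈ Icc (0 : ℝ) 1, Metric.closedBall (z₀ + s • (z₁ - z₀)) (h₀ + s * (h₁ - h₀)) ⊆
        S ∩ Metric.ball 0 1) →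
      ‖ballAverage f z₁ h₁ - ballAverage f z₀ h₀‖ ≤
        C * L * (energyMeasure g).real S ^ (1 / n : ℝ) := by
  obtain ⟨M, hM0, hM⟩ := exists_unitBump_le n
  set κ := volume.real (Metric.closedBall (0 : EuclideanSpace ℝ (Fin n)) 1) ^ (1 - 1 / n : ℝ) with hκ
  refine ⟨n * (M * κ), by positivity, ?_⟩
  intro f g hf hg hfg z₀ z₁ h₀ h₁ L hh₀ hh₁ hL S hS
  have hmin : ∀ s ∈ Icc (0 : ℝ) 1, min h₀ h₁ ≤ h₀ + s * (h₁ - h₀) := by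
    intro s hs
    have h1 := mul_le_mul_of_nonneg_left (min_le_left h₀ h₁) (sub_nonneg.2 hs.2)
    have h2 := mul_le_mul_of_nonneg_left (min_le_right h₀ h₁) hs.1
    linarith
  have hmin0 : 0 < min h₀ h₁ := lt_min hh₀ hh₁
  have hderiv : ∀ s ∈ Icc (0 : ℝ) 1, HasDerivWithinAt
      (fun s : ℝ => ballAverage f (z₀ + s • (z₁ - z₀)) (h₀ + s * (h₁ - h₀)))
      (∑ i, ∫ w in Metric.ball 0 1,
        ballFlux (z₀ + s • (z₁ - z₀)) (h₀ + s * (h₁ - h₀)) (z₁ - z₀) (h₁ - h₀) i w • g i w)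
      (Icc 0 1) s := by
    intro s hs
    have hpos := hmin0.trans_le (hmin s hs)
    rw [← integral_ballKernelDiv_smul hf hfg _ _ hpos ((hS s hs).trans inter_subset_right)]
    exact (hasDerivAt_ballAverage hf _ _ hpos).hasDerivWithinAt
  have hbound := norm_image_sub_le_of_norm_deriv_le_segment_01' hderiv
    (C := n * (M * κ) * L * (energyMeasure g).real S ^ (1 / n : ℝ)) (fun s hs => ?_)
  · simpa using hbound
  have hs : s ∈ Icc (0 : ℝ) 1 := ⟨hs.1, hs.2.le⟩
  have hle := hmin s hs
  have hpos := hmin0.trans_le hle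
  have hS' := hS s hs
  set z := z₀ + s • (z₁ - z₀)
  set h := h₀ + s * (h₁ - h₀)
  set v := z₁ - z₀
  set k := h₁ - h₀
  have hL0 : 0 ≤ L := by
    by_contra hneg
    have := mul_neg_of_neg_of_pos (not_le.1 hneg) hmin0
    have : 0 ≤ ‖v‖ + |k| := by positivity
    linarith
  have hvk : ‖v‖ + |k| ≤ L * h := hL.trans (mul_le_mul_of_nonneg_left hle hL0)
  have hterm : ∀ i ∈ Finset.univ, ‖∫ w in Metric.ball 0 1, ballFlux z h v k i w • g i w‖ ≤
      (M * κ) * L * (energyMeasure g).real S ^ (1 / n : ℝ) := by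
    intro i _
    have hsub : Metric.closedBall z h ⊆ Metric.ball 0 1 := hS'.trans inter_subset_right
    have hint : IntegrableOn (g i) (Metric.closedBall z h) := by
      have : IsFiniteMeasure (volume.restrict (Metric.closedBall z h)) :=
        isFiniteMeasure_restrict.2 measure_closedBall_lt_top.ne
      exact ((hg i).mono_measure (Measure.restrict_mono hsub le_rfl)).integrable
        (by exact_mod_cast hn)
    rw [setIntegral_eq_of_subset_of_forall_sdiff_eq_zero measurableSet_ball hsub (fun w hw => by
      rw [ballFlux, ballKernel_eq_zero hpos hw.2, zero_mul, zero_smul])]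
    calc _ ≤ ∫ w in Metric.closedBall z h, (h⁻¹) ^ n * M * (‖v‖ + |k|) * ‖g i w‖ := by
          refine norm_integral_le_of_norm_le (hint.norm.const_mul _) ?_
          filter_upwards [ae_restrict_mem measurableSet_closedBall] with w hw
          rw [norm_smul]
          exact mul_le_mul_of_nonneg_right (abs_ballFlux_le hM z v hpos i hw) (norm_nonneg _)
      _ = (h⁻¹) ^ n * M * (‖v‖ + |k|) * ∫ w in Metric.closedBall z h, ‖g i w‖ :=
          integral_const_mul _ _
      _ ≤ (h⁻¹) ^ n * M * (L * h) *
            ((energyMeasure g).real S ^ (1 / n : ℝ) * (h ^ (n - 1) * κ)) := by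
          gcongr
          exact setIntegral_norm_le_energyMeasure hn hg i hpos (hS'.trans inter_subset_left) hsub
      _ = ((h⁻¹) ^ n * (h ^ (n - 1) * h)) *
            (M * κ * L * (energyMeasure g).real S ^ (1 / n : ℝ)) := by ring
      _ = _ := by rw [pow_sub_one_mul (by omega), ← mul_pow, inv_mul_cancel₀ hpos.ne', one_pow, one_mul]
  refine (norm_sum_le_of_le _ hterm).trans_eq ?_
  simp
  ring

/-! ### Averages near the sphere and dyadic shells -/

/-- The points of the unit ball whose distance to the unit sphere is between `t / 8` and `t`. -/
def sphereShell (n : ℕ) (t : ℝ) : Set (EuclideanSpace ℝ (Fin n)) :=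
  {w | t / 8 ≤ 1 - ‖w‖ ∧ 1 - ‖w‖ ≤ t}

theorem measurableSet_sphereShell (n : ℕ) (t : ℝ) : MeasurableSet (sphereShell n t) :=
  (measurableSet_le measurable_const (measurable_const.sub measurable_norm)).inter
    (measurableSet_le (measurable_const.sub measurable_norm) measurable_const)

/-- The average of `f` over a ball of radius `t / 8` at distance `t / 2` from the point `c` of the
unit sphere. -/
noncomputable def boundaryAverage {n m : ℕ}
    (f : EuclideanSpace ℝ (Fin n) → EuclideanSpace ℝ (Fin m)) (t : ℝ)
    (c : EuclideanSpace ℝ (Fin n)) : EuclideanSpace ℝ (Fin m) :=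
  ballAverage f ((1 - t / 2) • c) (t / 8)

/-- The averaging ball lies within `t / 8 + t / 2 + t / 4 < t` of `x`. -/
theorem norm_boundaryAverage_sub_le {n m : ℕ}
    {f : EuclideanSpace ℝ (Fin n) → EuclideanSpace ℝ (Fin m)}
    (hf : ContinuousOn f (Metric.closedBall 0 1)) {t η : ℝ} (ht : 0 < t) (ht1 : t ≤ 1)
    (hη : ∀ z ∈ Metric.closedBall 0 1, ∀ w ∈ Metric.closedBall 0 1, dist z w ≤ t →
      ‖f z - f w‖ ≤ η) {c x : EuclideanSpace ℝ (Fin n)} (hc : ‖c‖ = 1) (hx : ‖x‖ = 1)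
    (hxc : dist x c ≤ t / 4) : ‖boundaryAverage f t c - f x‖ ≤ η := by
  have hz : ‖(1 - t / 2) • c‖ = 1 - t / 2 := by
    rw [norm_smul, hc, mul_one, Real.norm_of_nonneg (by linarith)]
  have hball : ∀ w ∈ Metric.closedBall ((1 - t / 2) • c) (t / 8), ‖w‖ < 1 := by
    intro w hw
    have h1 := norm_le_norm_add_norm_sub' w ((1 - t / 2) • c)
    rw [← dist_eq_norm] at h1
    have := Metric.mem_closedBall.1 hw
    linarith
  refine norm_ballAverage_sub_le hf (by linarith) (fun w hw => by simpa using hball w hw)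
    fun w hw => hη w (by simpa using (hball w hw).le) x (by simp [hx]) ?_
  have h1 := Metric.mem_closedBall.1 hw
  have h2 : dist ((1 - t / 2) • c) c = t / 2 := by
    rw [dist_eq_norm, sub_smul, one_smul, sub_sub_cancel_left, norm_neg, norm_smul, hc, mul_one,
      Real.norm_of_nonneg (by linarith)]
  have h3 := dist_triangle w ((1 - t / 2) • c) c
  have h4 := dist_triangle_right w x c
  linarith

theorem exists_norm_boundaryAverage_sub_le (n m : ℕ) (hn : 1 ≤ n) : ∃ C, 0 ≤ C ∧
    ∀ (f : EuclideanSpace ℝ (Fin n) → EuclideanSpace ℝ (Fin m))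
      (g : Fin n → EuclideanSpace ℝ (Fin n) → EuclideanSpace ℝ (Fin m)),
      ContinuousOn f (Metric.closedBall 0 1) →
      (∀ i, MemLp (g i) n (volume.restrict (Metric.ball 0 1))) →
      (∀ i, IsWeakPartialDeriv (Metric.ball 0 1) i f (g i)) →
      ∀ (t : ℝ) (c c' : EuclideanSpace ℝ (Fin n)), 0 < t → t ≤ 1 → ‖c‖ = 1 → ‖c'‖ = 1 →
      dist c c' ≤ 3 * t / 8 →
      ‖boundaryAverage f t c - boundaryAverage f (t / 2) c'‖ ≤
        C * (energyMeasure g).real (Metric.closedBall c' t ∩ sphereShell n t) ^ (1 / n : ℝ) := by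
  obtain ⟨C, hC, hCb⟩ := exists_norm_ballAverage_sub_le n m hn
  refine ⟨C * 11, by positivity, fun f g hf hg hfg t c c' ht ht1 hc hc' hcc' => ?_⟩
  rw [norm_sub_rev]
  have hz₀ : ‖(1 - t / 2) • c‖ = 1 - t / 2 := by
    rw [norm_smul, hc, mul_one, Real.norm_of_nonneg (by linarith)]
  have hz₁ : ‖(1 - t / 2 / 2) • c'‖ = 1 - t / 4 := by
    rw [norm_smul, hc', mul_one, Real.norm_of_nonneg (by linarith)]
    ring
  have hd₀ : ‖(1 - t / 2) • c - c'‖ ≤ 7 * t / 8 := by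
    have e : (1 - t / 2) • c - c' = (c - c') - (t / 2) • c := by module
    rw [e]
    refine (norm_sub_le _ _).trans ?_
    rw [norm_smul, hc, Real.norm_of_nonneg (by linarith), ← dist_eq_norm]
    linarith
  have hd₁ : ‖(1 - t / 2 / 2) • c' - c'‖ ≤ t / 4 := by
    have e : (1 - t / 2 / 2) • c' - c' = -((t / 4) • c') := by module
    rw [e, norm_neg, norm_smul, hc', Real.norm_of_nonneg (by linarith), mul_one]
  -- The centre moves by at most `3t/8 + t/4` and the radius by `t/16`, in total `11` times the
  -- smaller radius `t/16`.
  refine hCb f g hf hg hfg _ _ _ _ 11 (by linarith) (by linarith) ?_ _ ?_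
  · rw [min_eq_right (by linarith), abs_of_nonpos (by linarith)]
    have e : (1 - t / 2 / 2) • c' - (1 - t / 2) • c =
        (1 - t / 4) • (c' - c) + (t / 4) • c := by module
    have h1 : ‖(1 - t / 4) • (c' - c)‖ ≤ 3 * t / 8 := by
      rw [norm_smul, Real.norm_of_nonneg (by linarith), ← dist_eq_norm, dist_comm]
      exact (mul_le_of_le_one_left dist_nonneg (by linarith)).trans hcc'
    have h2 : ‖(t / 4) • c‖ = t / 4 := by
      rw [norm_smul, hc, Real.norm_of_nonneg (by linarith), mul_one]
    rw [e]
    have := norm_add_le ((1 - t / 4) • (c' - c)) ((t / 4) • c)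
    linarith
  · intro s hs w hw
    have hs0 := hs.1
    have hs1 := hs.2
    set z := (1 - t / 2) • c + s • ((1 - t / 2 / 2) • c' - (1 - t / 2) • c) with hz
    have hr : dist w z ≤ t / 8 := by
      refine (Metric.mem_closedBall.1 hw).trans ?_
      have : 0 ≤ s * t := by positivity
      linarith
    have hst : s * t ≤ t := mul_le_of_le_one_left ht.le hs1
    have hst0 : 0 ≤ s * t := by positivity
    have hzn : ‖z‖ ≤ 1 - t / 4 := by
      have e : z = (1 - s) • ((1 - t / 2) • c) + s • ((1 - t / 2 / 2) • c') := by
        rw [hz]; module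
      rw [e]
      refine (norm_add_le _ _).trans ?_
      rw [norm_smul (1 - s), norm_smul s, hz₀, hz₁, Real.norm_of_nonneg (by linarith),
        Real.norm_of_nonneg hs0]
      linarith
    have hzc : ‖z - c'‖ ≤ 7 * t / 8 := by
      have e : z - c' = (1 - s) • ((1 - t / 2) • c - c') + s • ((1 - t / 2 / 2) • c' - c') := by
        rw [hz]; module
      rw [e]
      refine (norm_add_le _ _).trans ?_
      rw [norm_smul (1 - s), norm_smul s, Real.norm_of_nonneg (by linarith),
        Real.norm_of_nonneg hs0]
      have h1 := mul_le_mul_of_nonneg_left hd₀ (by linarith : 0 ≤ 1 - s)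
      have h2 := mul_le_mul_of_nonneg_left hd₁ hs0
      linarith
    have hw1 : ‖w‖ ≤ 1 - t / 8 := by
      have := norm_le_norm_add_norm_sub' w z
      rw [← dist_eq_norm] at this
      linarith
    have hwc : dist w c' ≤ t := by
      have := dist_triangle w z c'
      rw [dist_eq_norm z] at this
      linarith
    refine ⟨⟨hwc, by linarith, ?_⟩, by simpa using (by linarith : ‖w‖ < 1)⟩
    have := norm_le_norm_add_norm_sub' c' w
    rw [← dist_eq_norm, dist_comm, hc'] at this
    linarith

/-- The depths in a shell span a factor `8`, so a point lies in at most four consecutive dyadic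
shells. -/
theorem sum_measure_sphereShell_le {n : ℕ} (μ : Measure (EuclideanSpace ℝ (Fin n))) (N : ℕ) :
    ∑ j ∈ Finset.range N, μ (sphereShell n ((1 / 2) ^ j)) ≤ 4 * μ univ := by
  refine sum_measure_le_of_card_le μ _ _ (fun j _ => measurableSet_sphereShell n _)
    MeasurableSet.univ (fun _ _ => subset_univ _) 4 fun x t _ ht => ?_
  rcases t.eq_empty_or_nonempty with rfl | hne
  · simp
  obtain ⟨i, hi, himin⟩ := Finset.exists_min_image _ id hne
  refine (Finset.card_le_card (t := Finset.Icc i (i + 3)) fun j hj => ?_).trans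
    (by rw [Nat.card_Icc]; omega)
  refine Finset.mem_Icc.2 ⟨himin j hj, ?_⟩
  have h1 := (ht i hi).1
  have h2 := (ht j hj).2
  have h3 : (1 / 2 : ℝ) ^ (i + 3) ≤ (1 / 2) ^ j := by
    rw [pow_add]; linarith
  exact (pow_le_pow_iff_right_of_lt_one₀ (by norm_num) (by norm_num)).1 h3

/-! ### The logarithmic estimate -/

/-- Apply `log x ≤ x - 1` to each ratio `d j / d (j + 1)` and to `1 / d 0`. -/
theorem log_inv_le_of_chain (N : ℕ) (d a : ℕ → ℝ) (hd : ∀ j, 0 < d j)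
    (h : ∀ j, d j ≤ d (j + 1) + a j) :
    Real.log (1 / d N) ≤ 1 / d 0 + ∑ j ∈ Finset.range N, a j / d (j + 1) := by
  induction N with
  | zero =>
    have := Real.log_le_sub_one_of_pos (one_div_pos.2 (hd 0))
    simp only [Finset.range_zero, Finset.sum_empty]
    linarith
  | succ N ih =>
    rw [Finset.sum_range_succ]
    have h1 := Real.log_le_sub_one_of_pos (div_pos (hd N) (hd (N + 1)))
    rw [Real.log_div (hd N).ne' (hd _).ne'] at h1
    have h2 : d N / d (N + 1) - 1 ≤ a N / d (N + 1) := by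
      rw [div_sub_one (hd _).ne']
      exact div_le_div_of_nonneg_right (by linarith [h N]) (hd _).le
    rw [one_div, Real.log_inv] at ih ⊢
    linarith

/-- The chain inequality for each Frostman point, averaged over the weights. The constant must not
depend on `N` or `η`, although the weights do. -/
theorem exists_log_inv_modulus_le {n m : ℕ} (hn : 2 ≤ n)
    {f : EuclideanSpace ℝ (Fin n) → EuclideanSpace ℝ (Fin m)}
    (hf : ContinuousOn f (Metric.closedBall 0 1))
    {g : Fin n → EuclideanSpace ℝ (Fin n) → EuclideanSpace ℝ (Fin m)}
    (hg : ∀ i, MemLp (g i) n (volume.restrict (Metric.ball 0 1)))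
    (hfg : ∀ i, IsWeakPartialDeriv (Metric.ball 0 1) i f (g i))
    (hH : Measure.hausdorffMeasure (n : ℝ) (f '' Metric.sphere 0 1) ≠ 0) :
    ∃ C, 0 ≤ C ∧ ∀ (N : ℕ) (η : ℝ), 0 < η →
      (∀ z ∈ Metric.closedBall 0 1, ∀ w ∈ Metric.closedBall 0 1, dist z w ≤ (1 / 2) ^ N →
        ‖f z - f w‖ ≤ η) →
      Real.log (1 / η) ≤ C * (1 + ∑ j ∈ Finset.range N,
        (energyMeasure g).real (sphereShell n ((1 / 2) ^ j)) ^ (1 / n : ℝ)) := by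
  classical
  have hn1 : 1 ≤ n := by omega
  have hn0 : n ≠ 0 := by omega
  have := isFiniteMeasure_energyMeasure hn1 hg
  set μ := energyMeasure g
  have hcomp : IsCompact (f '' Metric.sphere 0 1) := (isCompact_sphere _ _).image_of_continuousOn
    (hf.mono Metric.sphere_subset_closedBall)
  obtain ⟨R, hR, hdiam⟩ : ∃ R, 0 < R ∧ ∀ x ∈ f '' Metric.sphere 0 1, ∀ y ∈ f '' Metric.sphere 0 1,
      dist x y ≤ R := by
    obtain ⟨R, hR⟩ := Metric.isBounded_iff.1 hcomp.isBounded
    exact ⟨max R 1, by positivity, fun x hx y hy => (hR hx hy).trans (le_max_left _ _)⟩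
  obtain ⟨c, hc, hcov⟩ : ∃ c > 0, ∀ u : Finset (EuclideanSpace ℝ (Fin m) × ℝ), (∀ i ∈ u, 0 ≤ i.2) →
      (f '' Metric.sphere 0 1 ⊆ ⋃ i ∈ u, Metric.closedBall i.1 (6 * i.2)) →
      c < ∑ i ∈ u, i.2 ^ n := by
    by_contra! hcon
    exact hH (hausdorffMeasure_eq_zero_of_coverings hn0 hcon)
  -- The ratio `8` compares distance `2⁻ʲ` with the separation `2⁻⁽ʲ⁺¹⁾ / 4` of the next net.
  obtain ⟨K, hK⟩ := exists_card_le_of_separated (EuclideanSpace ℝ (Fin n)) 8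
  obtain ⟨A, hA, hAb⟩ := exists_norm_boundaryAverage_sub_le n m hn1
  refine ⟨8 * c ^ (-(1 / n : ℝ)) * (K : ℝ) ^ (1 / n : ℝ) * (1 + A), by positivity,
    fun N η hη hmod => ?_⟩
  obtain ⟨P, w, hPE, hw, hgrow, u, hu0, huE, huw⟩ :=
    exists_frostman_weights hcomp.totallyBounded hR hdiam n hη
  set W := ∑ p ∈ P, w p
  have hcW : c < W := (hcov u hu0 huE).trans_le huw
  have hW : 0 < W := hc.trans hcW
  have hPE' : ∀ p, p ∈ P → ∃ x, x ∈ Metric.sphere (0 : EuclideanSpace ℝ (Fin n)) 1 ∧ f x = p :=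
    fun p hp => hPE hp
  choose! σ hσ hfσ using hPE'
  have hσ1 : ∀ p ∈ P, ‖σ p‖ = 1 := fun p hp => by simpa using hσ p hp
  choose Q q hQX hQsep hq using fun j : ℕ =>
    exists_finset_net (P.image σ) (ρ := (1 / 2) ^ j / 4) (by positivity)
  have hQ1 : ∀ j, ∀ a ∈ Q j, ‖a‖ = 1 := by
    intro j a ha
    obtain ⟨p, hp, rfl⟩ := Finset.mem_image.1 (hQX j ha)
    exact hσ1 p hp
  have hqQ : ∀ j, ∀ p ∈ P, q j (σ p) ∈ Q j := fun j p hp => (hq j _ (Finset.mem_image_of_mem σ hp)).1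
  have hqd : ∀ j, ∀ p ∈ P, dist (σ p) (q j (σ p)) ≤ (1 / 2) ^ j / 4 := fun j p hp =>
    (hq j _ (Finset.mem_image_of_mem σ hp)).2
  have ht0 : ∀ j : ℕ, (0 : ℝ) < (1 / 2) ^ j := fun j => by positivity
  have ht1 : ∀ j : ℕ, (1 / 2 : ℝ) ^ j ≤ 1 := fun j => pow_le_one₀ (by norm_num) (by norm_num)
  set U : ℕ → EuclideanSpace ℝ (Fin n) → EuclideanSpace ℝ (Fin m) :=
    fun j => boundaryAverage f ((1 / 2) ^ j) with hU
  -- Truncation at `η` is needed because the weights have controlled growth only above that scale.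
  set d : ℕ → EuclideanSpace ℝ (Fin m) → ℝ := fun j p => max ‖U j (q j (σ p)) - p‖ η with hd
  have hd0 : ∀ j p, 0 < d j p := fun j p => hη.trans_le (le_max_right _ _)
  set S : ℕ → EuclideanSpace ℝ (Fin n) → Set (EuclideanSpace ℝ (Fin n)) := fun j k =>
    Metric.closedBall k ((1 / 2) ^ j) ∩ sphereShell n ((1 / 2) ^ j) with hS
  set α : ℕ → EuclideanSpace ℝ (Fin n) → ℝ := fun j k => A * μ.real (S j k) ^ (1 / n : ℝ) with hα
  have hα0 : ∀ j k, 0 ≤ α j k := fun j k => by positivity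
  -- Within one cell all distances are measured from the same average `U j k`, so a sublevel set of
  -- `d j` lies in a ball.
  have hcell : ∀ j k, ∀ r > 0, ∑ p ∈ P with q j (σ p) = k ∧ d j p ≤ r, w p ≤ 4 ^ n * r ^ n := by
    intro j k r hr
    rcases lt_or_ge r η with h | h
    · rw [Finset.filter_false_of_mem, Finset.sum_empty]
      · positivity
      · exact fun p _ hp => absurd ((le_max_right _ _).trans hp.2) (not_le.2 h)
    · refine le_trans (Finset.sum_le_sum_of_subset_of_nonneg (fun p hp => ?_) fun p _ _ => hw p)
        (hgrow (U j k) r h)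
      obtain ⟨hpP, rfl, hpd⟩ := Finset.mem_filter.1 hp
      refine Finset.mem_filter.2 ⟨hpP, ?_⟩
      rw [dist_comm, dist_eq_norm]
      exact (le_max_left _ _).trans hpd
  have h4 : ((4 : ℝ) ^ n) ^ (1 / n : ℝ) = 4 := by
    rw [one_div]; exact Real.pow_rpow_inv_natCast (by norm_num) hn0
  have hstep : ∀ p ∈ P, ∀ j, d j p ≤ d (j + 1) p + α j (q (j + 1) (σ p)) := by
    intro p hp j
    have e : (1 / 2 : ℝ) ^ (j + 1) = (1 / 2) ^ j / 2 := by rw [pow_succ]; ring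
    have h1 := hAb f g hf hg hfg ((1 / 2) ^ j) (q j (σ p)) (q (j + 1) (σ p)) (ht0 j) (ht1 j)
      (hQ1 _ _ (hqQ j p hp)) (hQ1 _ _ (hqQ (j + 1) p hp)) (by
        have h1 := hqd j p hp
        have h2 := hqd (j + 1) p hp
        have := dist_triangle_left (q j (σ p)) (q (j + 1) (σ p)) (σ p)
        rw [e] at h2
        linarith)
    rw [← e] at h1
    refine max_le ?_ ((le_max_right _ _).trans (le_add_of_nonneg_right (hα0 _ _)))
    have h2 := norm_sub_le_norm_sub_add_norm_sub (U j (q j (σ p)))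
      (U (j + 1) (q (j + 1) (σ p))) p
    have h3 : ‖U (j + 1) (q (j + 1) (σ p)) - p‖ ≤ d (j + 1) p := le_max_left _ _
    have h5 : ‖U j (q j (σ p)) - U (j + 1) (q (j + 1) (σ p))‖ ≤ α j (q (j + 1) (σ p)) := h1
    linarith
  have hdN : ∀ p ∈ P, d N p = η := by
    intro p hp
    refine max_eq_right ?_
    have := norm_boundaryAverage_sub_le hf (ht0 N) (ht1 N) hmod (hQ1 _ _ (hqQ N p hp)) (hσ1 p hp)
      (hqd N p hp)
    rwa [hfσ p hp] at this
  have hsum : W * Real.log (1 / η) ≤ ∑ p ∈ P, w p * (1 / d 0 p) +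
      ∑ j ∈ Finset.range N, ∑ p ∈ P, w p * (α j (q (j + 1) (σ p)) / d (j + 1) p) := by
    rw [Finset.sum_comm, ← Finset.sum_add_distrib, Finset.sum_mul]
    refine Finset.sum_le_sum fun p hp => ?_
    rw [← Finset.mul_sum, ← mul_add]
    refine mul_le_mul_of_nonneg_left ?_ (hw p)
    have := log_inv_le_of_chain N (fun j => d j p) (fun j => α j (q (j + 1) (σ p)))
      (fun j => hd0 j p) (hstep p hp)
    rwa [hdN p hp] at this
  have hfirst : ∑ p ∈ P, w p * (1 / d 0 p) ≤
      8 * W ^ (1 - 1 / n : ℝ) * (K : ℝ) ^ (1 / n : ℝ) := by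
    have h1 := sum_weight_mul_div_le hn (by positivity : (0 : ℝ) < 4 ^ n) w (d 0) hw (hd0 0) P
      (fun p => q 0 (σ p)) (Q 0) (hqQ 0) (fun _ => 1) (fun _ => zero_le_one) (hcell 0)
    rw [h4] at h1
    refine h1.trans ?_
    have hcard : (Q 0).card ≤ K := hK (1 / 4) (by norm_num) 0 (Q 0)
      (fun a ha b hb hab => by simpa using hQsep 0 a ha b hb hab)
      (fun a ha => by rw [dist_zero_right, hQ1 0 a ha]; norm_num)
    have : ∑ k ∈ Q 0, (1 : ℝ) ^ n ≤ K := by simpa using hcard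
    norm_num
    gcongr
  have hlevel : ∀ j, ∑ p ∈ P, w p * (α j (q (j + 1) (σ p)) / d (j + 1) p) ≤
      8 * W ^ (1 - 1 / n : ℝ) * (A * (K : ℝ) ^ (1 / n : ℝ) *
        μ.real (sphereShell n ((1 / 2) ^ j)) ^ (1 / n : ℝ)) := by
    intro j
    have h1 := sum_weight_mul_div_le hn (by positivity : (0 : ℝ) < 4 ^ n) w (d (j + 1)) hw
      (hd0 _) P (fun p => q (j + 1) (σ p)) (Q (j + 1)) (hqQ _) (α j) (hα0 j) (hcell (j + 1))
    rw [h4] at h1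
    refine h1.trans ?_
    have hover : ∑ k ∈ Q (j + 1), μ.real (S j k) ≤ K * μ.real (sphereShell n ((1 / 2) ^ j)) := by
      have h2 := sum_measure_le_of_card_le μ (Q (j + 1)) (S j)
        (fun k _ => measurableSet_closedBall.inter (measurableSet_sphereShell n _))
        (measurableSet_sphereShell n ((1 / 2) ^ j)) (fun k _ => inter_subset_right) K (fun x t htQ ht => by
          refine hK ((1 / 2) ^ (j + 1) / 4) (by positivity) x _ (fun a ha b hb hab => ?_)
            (fun a ha => ?_)
          · exact hQsep (j + 1) a (htQ ha) b (htQ hb) hab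
          · have := Metric.mem_closedBall.1 (ht a ha).1
            rw [dist_comm, pow_succ]
            linarith)
      have h3 := ENNReal.toReal_mono (by finiteness) h2
      rwa [ENNReal.toReal_sum (fun k _ => measure_ne_top _ _), ENNReal.toReal_mul,
        ENNReal.toReal_natCast] at h3
    have hpow : ∀ k, α j k ^ n = A ^ n * μ.real (S j k) := by
      intro k
      rw [hα, mul_pow, one_div, Real.rpow_inv_natCast_pow measureReal_nonneg hn0]
    have h5 : (∑ k ∈ Q (j + 1), α j k ^ n) ^ (1 / n : ℝ) ≤
        A * (K : ℝ) ^ (1 / n : ℝ) * μ.real (sphereShell n ((1 / 2) ^ j)) ^ (1 / n : ℝ) := by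
      simp only [hpow, ← Finset.mul_sum]
      calc _ ≤ (A ^ n * (K * μ.real (sphereShell n ((1 / 2) ^ j)))) ^ (1 / n : ℝ) := by
            gcongr
        _ = _ := by
            rw [Real.mul_rpow (by positivity) (by positivity),
              Real.mul_rpow (by positivity) (by positivity), one_div,
              Real.pow_rpow_inv_natCast hA hn0, mul_assoc]
    have h6 : 0 ≤ W ^ (1 - 1 / n : ℝ) := by positivity
    norm_num at h5 ⊢
    gcongr
  have hfinal : W * Real.log (1 / η) ≤ 8 * W ^ (1 - 1 / n : ℝ) * (K : ℝ) ^ (1 / n : ℝ) *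
      ((1 + A) * (1 + ∑ j ∈ Finset.range N, μ.real (sphereShell n ((1 / 2) ^ j)) ^ (1 / n : ℝ))) := by
    refine hsum.trans ((add_le_add hfirst (Finset.sum_le_sum fun j _ => hlevel j)).trans ?_)
    rw [← Finset.mul_sum, ← Finset.mul_sum]
    set T := ∑ j ∈ Finset.range N, μ.real (sphereShell n ((1 / 2) ^ j)) ^ (1 / n : ℝ)
    have hT : 0 ≤ T := Finset.sum_nonneg fun j _ => by positivity
    have h6 : 0 ≤ 8 * W ^ (1 - 1 / n : ℝ) * (K : ℝ) ^ (1 / n : ℝ) := by positivity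
    have h7 := mul_nonneg h6 (by positivity : 0 ≤ A + T)
    linarith
  -- The lower bound `c` on the mass makes the constant uniform in the weights.
  have hWpow : W ^ (1 - 1 / n : ℝ) ≤ W * c ^ (-(1 / n : ℝ)) := by
    rw [sub_eq_add_neg, Real.rpow_add hW, Real.rpow_one]
    refine mul_le_mul_of_nonneg_left ?_ hW.le
    exact Real.rpow_le_rpow_of_nonpos hc hcW.le (by simp)
  set T := ∑ j ∈ Finset.range N, μ.real (sphereShell n ((1 / 2) ^ j)) ^ (1 / n : ℝ)
  have hT : 0 ≤ T := Finset.sum_nonneg fun j _ => by positivity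
  refine le_of_mul_le_mul_left ?_ hW
  calc _ ≤ _ := hfinal
    _ ≤ 8 * (W * c ^ (-(1 / n : ℝ))) * (K : ℝ) ^ (1 / n : ℝ) * ((1 + A) * (1 + T)) := by gcongr
    _ = _ := by ring

/-! ### From the logarithmic estimate to the contradiction -/

/-- If dyadically `log (1 / ψ(2⁻ᴺ)) ≤ C ∑_{j ≤ N} b j` with `b ∈ ℓⁿ`, then the divergence condition
fails for the increasing function `ψ`. -/
theorem not_logDivergence {n : ℕ} (hn : 2 ≤ n) {ψ : ℝ → ℝ} (hmono : StrictMonoOn ψ (Ioi 0))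
    (hpos : ∀ t > 0, 0 < ψ t) (hone : ∃ t > 0, ψ t ≤ 1) {C B : ℝ} (hC : 0 ≤ C) (b : ℕ → ℝ)
    (hb : ∀ j, 0 ≤ b j) (hB : ∀ N, ∑ j ∈ Finset.range N, b j ^ n ≤ B)
    (hlog : ∀ N : ℕ, Real.log (1 / ψ ((1 / 2) ^ N)) ≤ C * ∑ j ∈ Finset.range (N + 1), b j) :
    ¬ LogDivergence n ψ := by
  intro hdiv
  obtain ⟨t₁, ht₁, hψ₁⟩ := hone
  -- Below `ε` one has `ψ ≤ 1`, and `N₀ ≥ 1` allows `N + 2 ≤ 3 * N` later.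
  obtain ⟨N₀, hN₀⟩ := exists_pow_lt_of_lt_one (lt_min ht₁ one_half_pos) one_half_lt_one
  have hN₀1 : 1 ≤ N₀ := by
    by_contra h
    have h0 : N₀ = 0 := by omega
    rw [h0, pow_zero] at hN₀
    have := hN₀.trans_le (min_le_right _ _)
    norm_num at this
  set ε : ℝ := (1 / 2) ^ N₀ with hε
  have hε0 : 0 < ε := by positivity
  have hε1 : ε < 1 := (hN₀.trans_le (min_le_right _ _)).trans one_half_lt_one
  have hp : ∀ k : ℕ, (0 : ℝ) < (1 / 2) ^ k := fun k => by positivity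
  set q : ℕ → ℝ := fun k => (∑ j ∈ Finset.range (k + 1), b j) / ((k : ℝ) + 1) with hq
  have hq0 : ∀ k, 0 ≤ q k := fun k => div_nonneg (Finset.sum_nonneg fun j _ => hb j) (by positivity)
  set D : ℝ := 3 * C / Real.log 2 with hD
  have hl2 : 0 < Real.log 2 := Real.log_pos one_lt_two
  set S : ℕ → Set ℝ := fun N => Ioc ((1 / 2) ^ (N + 1)) ((1 / 2) ^ N) ∩ Ioo 0 ε with hS
  -- Monotonicity compares `ψ t` with its value at the left endpoint. The factor `2 ^ (N + 1)` from
  -- `1 / t` will cancel the length of the interval.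
  have hpt : ∀ N, ∀ t ∈ S N, |Real.log (ψ t) / Real.log t| ^ n / t ≤
      (D * q (N + 1)) ^ n * 2 ^ (N + 1) := by
    intro N t ht
    obtain ⟨⟨h1, h2⟩, h3, h4⟩ := ht
    have hN : N₀ ≤ N := by
      have : (1 / 2 : ℝ) ^ (N + 1) < (1 / 2) ^ N₀ := h1.trans h4
      have := (pow_lt_pow_iff_right_of_lt_one₀ (by norm_num) (by norm_num)).1 this
      omega
    have hN1 : (1 : ℝ) ≤ N := by exact_mod_cast hN₀1.trans hN
    have hψ0 := hpos t h3
    have hψle : ψ t ≤ 1 := (hmono.monotoneOn h3 ht₁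
      (h4.trans (hN₀.trans_le (min_le_left _ _))).le).trans hψ₁
    have ha : |Real.log (ψ t)| ≤ C * ((N + 2) * q (N + 1)) := by
      rw [abs_of_nonpos (Real.log_nonpos hψ0.le hψle)]
      have h5 := Real.log_le_log (hpos _ (hp (N + 1))) (hmono.monotoneOn (hp (N + 1)) h3 h1.le)
      have h6 := hlog (N + 1)
      rw [one_div, Real.log_inv] at h6
      have h7 : ((N : ℝ) + 2) * q (N + 1) = ∑ j ∈ Finset.range (N + 1 + 1), b j := by
        simp only [hq]
        push_cast
        field_simp
        ring
      rw [h7]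
      linarith
    have hlt : N * Real.log 2 ≤ |Real.log t| := by
      rw [abs_of_neg (Real.log_neg h3 (h4.trans hε1))]
      have h5 := Real.log_le_log h3 h2
      rw [Real.log_pow, one_div, Real.log_inv] at h5
      linarith
    have hquot : |Real.log (ψ t) / Real.log t| ≤ D * q (N + 1) := by
      rw [abs_div]
      calc |Real.log (ψ t)| / |Real.log t| ≤ C * ((N + 2) * q (N + 1)) / (N * Real.log 2) := by
            have := hq0 (N + 1)
            gcongr
        _ ≤ C * ((3 * N) * q (N + 1)) / (N * Real.log 2) := by
            have := hq0 (N + 1)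
            gcongr
            linarith
        _ = D * q (N + 1) := by rw [hD]; field_simp
    have hD0 : 0 ≤ D * q (N + 1) := (abs_nonneg _).trans hquot
    rw [div_eq_mul_inv]
    refine mul_le_mul (pow_le_pow_left₀ (abs_nonneg _) hquot n) ?_ (by positivity) (by positivity)
    rw [inv_le_comm₀ h3 (by positivity), ← inv_pow, ← one_div]
    exact h1.le
  have hSint : ∀ N, ∫⁻ t in S N, ENNReal.ofReal (|Real.log (ψ t) / Real.log t| ^ n / t) ≤
      ENNReal.ofReal ((D * q (N + 1)) ^ n) := by
    intro N
    have hD0 : 0 ≤ D * q (N + 1) := mul_nonneg (by positivity) (hq0 _)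
    calc _ ≤ ∫⁻ t in S N, ENNReal.ofReal ((D * q (N + 1)) ^ n * 2 ^ (N + 1)) :=
          setLIntegral_mono measurable_const fun t ht => ENNReal.ofReal_le_ofReal (hpt N t ht)
      _ = ENNReal.ofReal ((D * q (N + 1)) ^ n * 2 ^ (N + 1)) * volume (S N) := setLIntegral_const _ _
      _ ≤ ENNReal.ofReal ((D * q (N + 1)) ^ n * 2 ^ (N + 1)) *
            ENNReal.ofReal ((1 / 2) ^ (N + 1)) := by
          gcongr
          refine (measure_mono inter_subset_left).trans_eq ?_
          rw [Real.volume_Ioc]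
          congr 1
          rw [pow_succ]
          ring
      _ = _ := by
          rw [← ENNReal.ofReal_mul (by positivity), mul_assoc, ← mul_pow]
          norm_num
  have hcover : Ioo 0 ε ⊆ ⋃ N, S N := by
    intro t ht
    obtain ⟨N, h1, h2⟩ := exists_nat_pow_near_of_lt_one ht.1 (ht.2.trans hε1).le one_half_pos
      one_half_lt_one
    exact mem_iUnion.2 ⟨N, ⟨h1, h2⟩, ht⟩
  have hD0 : 0 ≤ D := by positivity
  have hpartial : ∀ M, ∑ N ∈ Finset.range M, ENNReal.ofReal ((D * q (N + 1)) ^ n) ≤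
      ENNReal.ofReal (D ^ n * (4 ^ n * B)) := by
    intro M
    rw [← ENNReal.ofReal_sum_of_nonneg fun N _ =>
      pow_nonneg (mul_nonneg hD0 (hq0 (N + 1))) n]
    refine ENNReal.ofReal_le_ofReal ?_
    simp only [mul_pow, ← Finset.mul_sum]
    refine mul_le_mul_of_nonneg_left ?_ (by positivity)
    have h1 := sum_average_pow_le b hb hn (M + 1)
    have h2 := mul_le_mul_of_nonneg_left (hB (M + 1)) (by positivity : (0 : ℝ) ≤ 4 ^ n)
    rw [Finset.sum_range_succ'] at h1
    have h3 : 0 ≤ ((∑ j ∈ Finset.range (0 + 1), b j) / (((0 : ℕ) : ℝ) + 1)) ^ n :=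
      pow_nonneg (hq0 0) n
    simp only [hq]
    linarith
  have hfin : ∫⁻ t in Ioo 0 ε, ENNReal.ofReal (|Real.log (ψ t) / Real.log t| ^ n / t) ≤
      ENNReal.ofReal (D ^ n * (4 ^ n * B)) :=
    calc _ ≤ ∫⁻ t in ⋃ N, S N, ENNReal.ofReal (|Real.log (ψ t) / Real.log t| ^ n / t) :=
          lintegral_mono_set hcover
      _ ≤ ∑' N, ∫⁻ t in S N, ENNReal.ofReal (|Real.log (ψ t) / Real.log t| ^ n / t) :=
          lintegral_iUnion_le _ _
      _ ≤ ∑' N, ENNReal.ofReal ((D * q (N + 1)) ^ n) := ENNReal.tsum_le_tsum hSint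
      _ ≤ _ := ENNReal.tsum_le_of_sum_range_le hpartial
  rw [hdiv ε hε0] at hfin
  exact ENNReal.ofReal_ne_top (top_le_iff.1 hfin)

theorem finite_sphere_euclideanSpace_fin_one :
    (Metric.sphere (0 : EuclideanSpace ℝ (Fin 1)) 1).Finite := by
  refine (Set.toFinite {EuclideanSpace.single 0 1, EuclideanSpace.single 0 (-1)}).subset ?_
  intro x hx
  have hx1 : |x 0| = 1 := by
    have := mem_sphere_zero_iff_norm.1 hx
    rwa [EuclideanSpace.norm_eq, Fin.sum_univ_one, Real.sqrt_sq (norm_nonneg _),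
      Real.norm_eq_abs] at this
  rcases eq_or_eq_neg_of_abs_eq hx1 with h | h
  · left
    ext i
    fin_cases i
    simpa using h
  · right
    ext i
    fin_cases i
    simpa using h

theorem theorem1p1 (n m : ℕ) (hn : 1 ≤ n)
    (f : EuclideanSpace ℝ (Fin n) → EuclideanSpace ℝ (Fin m))
    (hf : MemSobolevOne (Metric.ball 0 1) (n : ℝ≥0∞) f)
    (hcont : ContinuousOn f (Metric.closedBall 0 1))
    (ψ : ℝ → ℝ) (hψ : IsAllowableModulus ψ)
    (hmod : ∀ z ∈ Metric.closedBall (0 : EuclideanSpace ℝ (Fin n)) 1,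
      ∀ w ∈ Metric.closedBall (0 : EuclideanSpace ℝ (Fin n)) 1,
        z ≠ w → ‖f z - f w‖ ≤ ψ ‖z - w‖)
    (hdiv : LogDivergence n ψ) :
    Measure.hausdorffMeasure (n : ℝ) (f '' Metric.sphere 0 1) = 0 := by
  -- Hardy's inequality needs an exponent above `1`, so `n = 1` is separate: a finite set is null
  -- for one-dimensional measure.
  rcases hn.eq_or_lt with rfl | hn2
  · have := Measure.nullSingletonClass_hausdorff (EuclideanSpace ℝ (Fin m)) (d := ((1 : ℕ) : ℝ)) (by norm_num)
    exact (finite_sphere_euclideanSpace_fin_one.image f).measure_zero _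
  by_contra hH
  choose g hg hfg using hf.exists_weakDeriv
  have := isFiniteMeasure_energyMeasure hn hg
  obtain ⟨C, hC, hlog⟩ := exists_log_inv_modulus_le hn2 hcont hg hfg hH
  have hpos : ∀ t > 0, 0 < ψ t := fun t ht => hψ.bijOn.mapsTo ht
  set μ := energyMeasure g
  have hn0 : n ≠ 0 := by omega
  refine not_logDivergence hn2 hψ.strictMonoOn hpos ?_ hC
    -- The entry `1` at index `0` absorbs the additive constant of the logarithmic estimate; hence
    -- the `+ 1` in `B`.
    (fun j => Nat.casesOn j 1 fun j => μ.real (sphereShell n ((1 / 2) ^ j)) ^ (1 / n : ℝ))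
    (B := 4 * μ.real univ + 1) ?_ ?_ ?_ hdiv
  · obtain ⟨t, ht, h⟩ := hψ.bijOn.surjOn (mem_Ioi.2 one_pos)
    exact ⟨t, ht, h.le⟩
  · rintro (_ | j)
    · exact zero_le_one
    · exact Real.rpow_nonneg measureReal_nonneg _
  · rintro (_ | N)
    · simp; positivity
    · rw [Finset.sum_range_succ']
      have h1 := ENNReal.toReal_mono (by finiteness) (sum_measure_sphereShell_le μ N)
      rw [ENNReal.toReal_sum fun _ _ => measure_ne_top _ _, ENNReal.toReal_mul] at h1
      simp only [one_div, Real.rpow_inv_natCast_pow measureReal_nonneg hn0]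
      simp only [one_div] at h1
      simpa [measureReal_def] using h1
  · intro N
    have := hlog N (ψ ((1 / 2) ^ N)) (hpos _ (by positivity)) (fun z hz w hw hzw => by
      rcases eq_or_ne z w with rfl | hne
      · rw [sub_self, norm_zero]; exact (hpos _ (by positivity)).le
      · rw [dist_eq_norm] at hzw
        exact (hmod z hz w hw hne).trans (hψ.strictMonoOn.monotoneOn
          (norm_pos_iff.2 (sub_ne_zero.2 hne)) (by positivity : (0 : ℝ) < (1 / 2) ^ N) hzw))
    rw [Finset.sum_range_succ', add_comm]
    exact this
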